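/- **Theorem (odometers are not separably axiomatizable).** For a sequence $a=(a_n)_{n\ge 1}$ of integers $a_n\ge 2$ let $\sigma_a$ be the homeomorphism "add $1$ to the first digit, with carry to the right" of $X_a=\prod_n\{0,\dots,a_n-1\}$ (product topology). An *odometer* is a dynamical system topologically conjugate to some $(X_a,\sigma_a)$. For a homeomorphism $S$ of a compact Hausdorff space $X$, also write $S$ for the automorphism $f\mapsto f\circ S$ of $C(X)$. Regard commutative unital C*-algebras with an automorphism as metric structures in the language of unital C*-algebras with an additional unary function symbol for the automorphism (continuous logic: atomic formulas are norms of terms, connectives are continuous functions $\mathbb R^k\to\mathbb R$, quantifiers are $\sup$ and $\inf$ over the balls of radius $r\in\mathbb N$; a theory is a set of sentences $\varphi$, each read as the condition $\varphi=0$). 1. The property of being an odometer on the Cantor set is not separably axiomatizable: there is no theory $T$ such that a separable structure $(A,\sigma)$ of the above kind is a model of $T$ if and only if $(A,\sigma)\cong(C(X),S)$ for some odometer $(X,S)$ on a Cantor set $X$. 2. Moreover, for each prime $p$ let $(X_p,\sigma_p)$ be the odometer of the constant sequence $(p,p,p,\dots)$, let $\mathcal U$ be any nonprincipal ultrafilter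 on the set of primes, and let $(A,\sigma)=\prod_{\mathcal U}(C(X_p),\sigma_p)$ be the ultraproduct (bounded families modulo families whose norms tend to $0$ along $\mathcal U$). Then $(A,\sigma)$ has a separable elementary substructure. Every separable elementary substructure $(A_0,\sigma_0)$ of $(A,\sigma)$ is a model of every theory that has all $(C(X_p),\sigma_p)$ as models; and whenever $(A_0,\sigma_0)\cong(C(Y),\tau)$ for a homeomorphism $\tau$ of a compact Hausdorff space $Y$, there are no integers $a_n\ge2$ and partitions $P_0=\{Y\},P_1,P_2,\dots$ of $Y$ into nonempty clopen sets such that, for all $n\ge 1$, every member of $P_{n-1}$ is the union of exactly $a_n$ members of $P_n$, and $\tau$ permutes the $a_1\cdots a_n$ members of $P_n$ in a single cycle. -/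

import Mathlib

open scoped ENNReal Topology

noncomputable section

namespace CStarDyn

/-! ### Continuous logic for unital C⋆-algebras with an automorphism -/

/-- Terms with free variables among `x₀, …, xₙ₋₁`: the `⋆`-polynomials with complex coefficients
that may also involve the unary function symbol for the automorphism. -/
inductive Term (n : ℕ) : Type
  | var (i : Fin n) : Term n
  | zero : Term n
  | one : Term n
  | plus (s t : Term n) : Term n
  | times (s t : Term n) : Term n
  | smul (c : ℂ) (t : Term n) : Term n
  | adj (t : Term n) : Term n
  | aut (t : Term n) : Term n

/-- Formulas of continuous logic with free variables among `x₀, …, xₙ₋₁`.  Atomic formulas are the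
norms of terms, the connectives are all continuous functions `ℝᵏ → ℝ`, and the quantifiers are the
supremum and the infimum over the ball of radius `r`, for the sorts `r = 0, 1, 2, …`. -/
inductive Formula : ℕ → Type
  | normOf {n : ℕ} (t : Term n) : Formula n
  | conn {n k : ℕ} (u : C(Fin k → ℝ, ℝ)) (φ : Fin k → Formula n) : Formula n
  | sup {n : ℕ} (r : ℕ) (φ : Formula (n + 1)) : Formula n
  | inf {n : ℕ} (r : ℕ) (φ : Formula (n + 1)) : Formula n

/-- A sentence is a formula without free variables. -/
abbrev Sentence : Type := Formula 0

/-- A theory is a set of sentences `φ`, each read as the condition `φ = 0`. -/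
abbrev Theory : Type := Set Sentence

section Semantics

variable {A : Type*} [CommCStarAlgebra A] (σ : A ≃⋆ₐ[ℂ] A)

/-- The interpretation of a term in the structure `(A, σ)`. -/
def Term.eval {n : ℕ} (v : Fin n → A) : Term n → A
  | .var i => v i
  | .zero => 0
  | .one => 1
  | .plus s t => s.eval v + t.eval v
  | .times s t => s.eval v * t.eval v
  | .smul c t => c • t.eval v
  | .adj t => star (t.eval v)
  | .aut t => σ (t.eval v)

/-- The value of a formula in the structure `(A, σ)` at an assignment of its free variables.
The newly bound variable is `x₀`; the other ones are shifted by one. -/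
def Formula.eval : {n : ℕ} → Formula n → (Fin n → A) → ℝ
  | _, .normOf t, v => ‖t.eval σ v‖
  | _, .conn u φ, v => u fun i => (φ i).eval v
  | _, .sup r φ, v => ⨆ x : Metric.closedBall (0 : A) r, φ.eval (Fin.cons (x : A) v)
  | _, .inf r φ, v => ⨅ x : Metric.closedBall (0 : A) r, φ.eval (Fin.cons (x : A) v)

/-- `(A, σ)` is a model of the theory `T`. -/
def Models (T : Theory) : Prop := ∀ φ ∈ T, φ.eval σ (Fin.elim0 : Fin 0 → A) = 0

/-- `j` identifies `(A, σ)` with an elementary substructure of `(B, τ)`: all formulas take the same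
values in both structures at tuples from `A`.  (Applied to the atomic formulas this gives that `j`
is isometric and that `j ∘ σ = τ ∘ j`.) -/
def IsElementaryEmbedding {B : Type*} [CommCStarAlgebra B] (τ : B ≃⋆ₐ[ℂ] B) (j : A →⋆ₐ[ℂ] B) :
    Prop :=
  ∀ (n : ℕ) (φ : Formula n) (v : Fin n → A), φ.eval τ (fun i => j (v i)) = φ.eval σ v

/-- `(A, σ)` and `(B, τ)` are isomorphic. -/
def Isomorphic {B : Type*} [CommCStarAlgebra B] (τ : B ≃⋆ₐ[ℂ] B) : Prop :=
  ∃ Φ : A ≃⋆ₐ[ℂ] B, ∀ x, Φ (σ x) = τ (Φ x)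

end Semantics

/-- The automorphism `f ↦ f ∘ S` of `C(X)` induced by a homeomorphism `S` of `X`. -/
def inducedAut {X : Type*} [TopologicalSpace X] [CompactSpace X] (S : X ≃ₜ X) :
    C(X, ℂ) ≃⋆ₐ[ℂ] C(X, ℂ) :=
  S.compStarAlgEquiv' ℂ ℂ

/-- The property `P` of topological dynamical systems is separably axiomatizable for the class `𝒞`
of compact metrizable spaces: there is a theory whose separable models are, up to isomorphism,
exactly the structures `(C(X), S)` with `X` in `𝒞` and `S` satisfying `P`.  The structures that
are considered are the commutative unital C⋆-algebras with an automorphism. (A separable one has at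
most continuum many elements, so those in `Type` are all of them up to isomorphism.) -/
def SeparablyAxiomatizable (𝒞 : ∀ (X : Type) [TopologicalSpace X], Prop)
    (P : ∀ (X : Type) [TopologicalSpace X], (X ≃ₜ X) → Prop) : Prop :=
  ∃ T : Theory, ∀ (A : Type) [CommCStarAlgebra A] [TopologicalSpace.SeparableSpace A]
    (σ : A ≃⋆ₐ[ℂ] A),
    Models σ T ↔
      ∃ (X : Type) (_ : TopologicalSpace X) (_ : CompactSpace X)
        (_ : TopologicalSpace.MetrizableSpace X) (S : X ≃ₜ X),
        𝒞 X ∧ P X S ∧ Isomorphic σ (inducedAut S)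

/-- `X` is a Cantor set. -/
def IsCantorSet (X : Type) [TopologicalSpace X] : Prop := Nonempty (X ≃ₜ (ℕ → Bool))

/-! ### Odometers -/

section Odometer

variable (a : ℕ → ℕ)

/-- Addition of `1` with carry to the right: the `n`-th digit is increased (modulo `a n`) exactly if
all earlier digits are maximal, and is left alone otherwise. -/
def odometerFun (b : ∀ n, Fin (a n)) : ∀ n, Fin (a n) := fun n =>
  open Classical in
  if ∀ i < n, (b i : ℕ) + 1 = a i then ⟨(b n + 1) % a n, Nat.mod_lt _ (b n).pos⟩ else b n

/-- Subtraction of `1` with borrow to the right. -/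
def odometerInv (b : ∀ n, Fin (a n)) : ∀ n, Fin (a n) := fun n =>
  open Classical in
  if ∀ i < n, (b i : ℕ) = 0 then ⟨(b n + (a n - 1)) % a n, Nat.mod_lt _ (b n).pos⟩ else b n

theorem succ_mod_eq_zero_iff {m k : ℕ} (h : k < m) : (k + 1) % m = 0 ↔ k + 1 = m := by
  rcases Nat.lt_or_ge (k + 1) m with h' | h'
  · rw [Nat.mod_eq_of_lt h']; omega
  · have : k + 1 = m := by omega
    simp [this]

theorem pred_mod_succ_eq_iff {m k : ℕ} (h : k < m) : (k + (m - 1)) % m + 1 = m ↔ k = 0 := by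
  rcases Nat.eq_zero_or_pos k with rfl | h'
  · rw [Nat.zero_add, Nat.mod_eq_of_lt (by omega)]; omega
  · have : k + (m - 1) = (k - 1) + m := by omega
    rw [this, Nat.add_mod_right, Nat.mod_eq_of_lt (by omega)]; omega

theorem odometerFun_carry (b : ∀ n, Fin (a n)) (n : ℕ) :
    (∀ i < n, (odometerFun a b i : ℕ) = 0) ↔ ∀ i < n, (b i : ℕ) + 1 = a i := by
  induction n with
  | zero => simp
  | succ n ih =>
    rw [Nat.forall_lt_succ_right, Nat.forall_lt_succ_right, ih]
    refine and_congr_right fun h => ?_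
    rw [odometerFun, if_pos h]
    exact succ_mod_eq_zero_iff (b n).isLt

theorem odometerInv_borrow (b : ∀ n, Fin (a n)) (n : ℕ) :
    (∀ i < n, (odometerInv a b i : ℕ) + 1 = a i) ↔ ∀ i < n, (b i : ℕ) = 0 := by
  induction n with
  | zero => simp
  | succ n ih =>
    rw [Nat.forall_lt_succ_right, Nat.forall_lt_succ_right, ih]
    refine and_congr_right fun h => ?_
    rw [odometerInv, if_pos h]
    exact pred_mod_succ_eq_iff (b n).isLt

theorem odometer_left_inv : Function.LeftInverse (odometerInv a) (odometerFun a) := by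
  intro b
  funext n
  rw [odometerInv]
  by_cases h : ∀ i < n, (b i : ℕ) + 1 = a i
  · rw [if_pos ((odometerFun_carry a b n).2 h)]
    ext
    have hb := (b n).isLt
    simp only [odometerFun, if_pos h]
    have e : (b n : ℕ) + 1 + (a n - 1) = b n + a n := by omega
    rw [Nat.mod_add_mod, e, Nat.add_mod_right, Nat.mod_eq_of_lt hb]
  · rw [if_neg (mt (odometerFun_carry a b n).1 h), odometerFun, if_neg h]

theorem odometer_right_inv : Function.RightInverse (odometerInv a) (odometerFun a) := by
  intro b
  funext n
  rw [odometerFun]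
  by_cases h : ∀ i < n, (b i : ℕ) = 0
  · rw [if_pos ((odometerInv_borrow a b n).2 h)]
    ext
    have hb := (b n).isLt
    simp only [odometerInv, if_pos h]
    have e : (b n : ℕ) + (a n - 1) + 1 = b n + a n := by omega
    rw [Nat.mod_add_mod, e, Nat.add_mod_right, Nat.mod_eq_of_lt hb]
  · rw [if_neg (mt (odometerInv_borrow a b n).1 h), odometerInv, if_neg h]

theorem continuous_of_initial {F : (∀ n, Fin (a n)) → ∀ n, Fin (a n)}
    (hF : ∀ n b c, (∀ i ≤ n, b i = c i) → F b n = F c n) : Continuous F := by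
  refine continuous_pi fun n => continuous_discrete_rng.2 fun k => ?_
  rw [isOpen_iff_mem_nhds]
  intro b hb
  have hn : ∀ᶠ c in 𝓝 b, ∀ i ∈ Set.Iic n, c i = b i := by
    rw [Filter.eventually_all_finite (Set.finite_Iic n)]
    intro i _
    exact (continuous_apply i).continuousAt.eventually
      ((isOpen_discrete {b i}).mem_nhds rfl)
  filter_upwards [hn] with c hc
  simp only [Set.mem_preimage, Set.mem_singleton_iff] at hb ⊢
  rw [← hb]
  exact hF n c b fun i hi => hc i hi

theorem continuous_odometerFun : Continuous (odometerFun a) := by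
  refine continuous_of_initial a fun n b c h => ?_
  have e : (∀ i < n, (b i : ℕ) + 1 = a i) ↔ ∀ i < n, (c i : ℕ) + 1 = a i :=
    forall₂_congr fun i hi => by rw [h i hi.le]
  simp only [odometerFun, e, h n le_rfl]

theorem continuous_odometerInv : Continuous (odometerInv a) := by
  refine continuous_of_initial a fun n b c h => ?_
  have e : (∀ i < n, (b i : ℕ) = 0) ↔ ∀ i < n, (c i : ℕ) = 0 :=
    forall₂_congr fun i hi => by rw [h i hi.le]
  simp only [odometerInv, e, h n le_rfl]

/-- The odometer map of the sequence `a` on `∏ₙ {0, …, a n - 1}` with the product topology. -/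
def odometer : (∀ n, Fin (a n)) ≃ₜ (∀ n, Fin (a n)) where
  toFun := odometerFun a
  invFun := odometerInv a
  left_inv := odometer_left_inv a
  right_inv := odometer_right_inv a
  continuous_toFun := continuous_odometerFun a
  continuous_invFun := continuous_odometerInv a

end Odometer

/-- `(X, S)` is an odometer: it is conjugate to the odometer map of a sequence of integers `≥ 2`. -/
def IsOdometer (X : Type) [TopologicalSpace X] (S : X ≃ₜ X) : Prop :=
  ∃ a : ℕ → ℕ, (∀ n, 2 ≤ a n) ∧
    ∃ h : X ≃ₜ (∀ n, Fin (a n)), ∀ x, h (S x) = odometer a (h x)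

/-- The structure `(C(X_p), σ_p)` of the odometer for the constant sequence `(p, p, p, …)`. -/
def pOdometerAut (p : ℕ) : C(ℕ → Fin p, ℂ) ≃⋆ₐ[ℂ] C(ℕ → Fin p, ℂ) :=
  inducedAut (odometer fun _ => p)

/-- `Y` has a refining sequence of clopen partitions which `τ` permutes in the way in which an
odometer permutes its cylinder sets: `P 0` is the trivial partition, every member of `P n` is the
union of exactly `a n ≥ 2` members of `P (n + 1)`, and `τ` permutes each `P n` in one cycle (of
length `a 0 ⋯ a (n - 1)`). -/
def HasOdometerPartitions {Y : Type*} [TopologicalSpace Y] (τ : Y ≃ₜ Y) : Prop :=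
  ∃ (a : ℕ → ℕ) (P : ℕ → Set (Set Y)),
    (∀ n, 2 ≤ a n) ∧
    P 0 = {Set.univ} ∧
    (∀ n, (P n).ncard = ∏ i ∈ Finset.range n, a i) ∧
    (∀ n, ∀ B ∈ P n, IsClopen B ∧ B.Nonempty) ∧
    (∀ n, (P n).PairwiseDisjoint id) ∧
    (∀ n, ⋃₀ P n = Set.univ) ∧
    (∀ n, ∀ B ∈ P n, {B' ∈ P (n + 1) | B' ⊆ B}.ncard = a n ∧
      ⋃₀ {B' ∈ P (n + 1) | B' ⊆ B} = B) ∧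
    (∀ n, ∀ B ∈ P n, τ '' B ∈ P n) ∧
    (∀ n, ∀ B ∈ P n, ∀ B' ∈ P n, ∃ k : ℕ, (τ^[k]) '' B = B')

/-! ### Ultraproducts -/

section Ultraproduct

variable {ι : Type*} (U : Ultrafilter ι) (A : ι → Type*) [∀ i, CommCStarAlgebra (A i)]
  [∀ i, Nontrivial (A i)]

/-- The ideal of the bounded families whose norms tend to `0` along `U`. -/
def nullIdeal : Ideal (lp A ∞) where
  carrier := {f | Filter.Tendsto (fun i => ‖f i‖) U (𝓝 0)}
  zero_mem' := by simp
  add_mem' {f g} hf hg := by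
    simp only [Set.mem_ofPred_eq] at hf hg ⊢
    refine squeeze_zero (fun i => norm_nonneg _) (fun i => ?_) (by simpa using hf.add hg)
    exact norm_add_le (f i) (g i)
  smul_mem' c f hf := by
    simp only [Set.mem_ofPred_eq] at hf ⊢
    refine squeeze_zero (fun i => norm_nonneg _) (fun i => ?_) (by simpa using hf.const_mul ‖c‖)
    calc ‖(c • f) i‖ = ‖c i * f i‖ := rfl
      _ ≤ ‖c i‖ * ‖f i‖ := norm_mul_le _ _
      _ ≤ ‖c‖ * ‖f i‖ := by gcongr; exact lp.norm_apply_le_norm (by simp) c i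

variable {A}

theorem mem_nullIdeal {f : lp A ∞} :
    f ∈ nullIdeal U A ↔ Filter.Tendsto (fun i => ‖f i‖) U (𝓝 0) := Iff.rfl

theorem mem_nullIdeal_iff {f : lp A ∞} :
    f ∈ nullIdeal U A ↔ ∀ ε > 0, ∀ᶠ i in (U : Filter ι), ‖f i‖ < ε := by
  rw [mem_nullIdeal, Metric.tendsto_nhds]
  simp

instance isClosed_nullIdeal : IsClosed (nullIdeal U A : Set (lp A ∞)) := by
  refine isClosed_of_closure_subset fun f hf => ?_
  rw [SetLike.mem_coe, mem_nullIdeal_iff]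
  intro ε hε
  obtain ⟨g, hg, hfg⟩ := Metric.mem_closure_iff.1 hf (ε / 2) (half_pos hε)
  filter_upwards [(mem_nullIdeal_iff U).1 hg (ε / 2) (half_pos hε)] with i hi
  have h1 : ‖(f - g) i‖ ≤ ‖f - g‖ := lp.norm_apply_le_norm (by simp) (f - g) i
  have h2 : ‖f i‖ ≤ ‖(f - g) i‖ + ‖g i‖ := by
    have : f i = (f - g) i + g i := by simp
    conv_lhs => rw [this]
    exact norm_add_le _ _
  rw [dist_eq_norm] at hfg
  linarith

theorem norm_mk_le {f : lp A ∞} {r : ℝ} (hr : 0 ≤ r) (h : ∀ᶠ i in (U : Filter ι), ‖f i‖ ≤ r) :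
    ‖Ideal.Quotient.mk (nullIdeal U A) f‖ ≤ r := by
  classical
  have hb : ∀ i, ‖(if ‖f i‖ ≤ r then f i else 0)‖ ≤ r := fun i => by
    split_ifs with hi
    · exact hi
    · simpa using hr
  let g : lp A ∞ := ⟨fun i => if ‖f i‖ ≤ r then f i else 0,
    memℓp_infty ⟨r, by rintro _ ⟨i, rfl⟩; exact hb i⟩⟩
  have hg : ‖g‖ ≤ r := lp.norm_le_of_forall_le hr hb
  have e : Ideal.Quotient.mk (nullIdeal U A) f = Ideal.Quotient.mk (nullIdeal U A) g := by
    rw [Ideal.Quotient.eq, mem_nullIdeal_iff]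
    intro ε hε
    filter_upwards [h] with i hi
    have : (f - g) i = 0 := by
      change f i - (if ‖f i‖ ≤ r then f i else 0) = 0
      rw [if_pos hi, sub_self]
    rw [this]
    simpa using hε
  rw [e]
  exact (Ideal.Quotient.norm_mk_le _ g).trans hg

theorem eventually_lt_of_norm_mk_lt {f : lp A ∞} {r : ℝ}
    (h : ‖Ideal.Quotient.mk (nullIdeal U A) f‖ < r) : ∀ᶠ i in (U : Filter ι), ‖f i‖ < r := by
  obtain ⟨g, hg, hgr⟩ := Ideal.Quotient.norm_mk_lt (Ideal.Quotient.mk (nullIdeal U A) f)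
    (half_pos (sub_pos.2 h))
  rw [eq_comm, Ideal.Quotient.eq, mem_nullIdeal_iff] at hg
  filter_upwards [hg _ (half_pos (sub_pos.2 h))] with i hi
  have h1 : ‖g i‖ ≤ ‖g‖ := lp.norm_apply_le_norm (by simp) g i
  have h2 : ‖f i‖ ≤ ‖(f - g) i‖ + ‖g i‖ := by
    have : f i = (f - g) i + g i := by simp
    conv_lhs => rw [this]
    exact norm_add_le _ _
  linarith

variable (A)

/-- The metric ultraproduct of the C⋆-algebras `A i` along `U`: bounded families modulo the families
whose norms tend to `0` along `U`. -/
def Ultraproduct : Type _ := lp A ∞ ⧸ nullIdeal U A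

instance : NormedCommRing (Ultraproduct U A) :=
  inferInstanceAs (NormedCommRing (lp A ∞ ⧸ nullIdeal U A))

instance : NormedAlgebra ℂ (Ultraproduct U A) :=
  inferInstanceAs (NormedAlgebra ℂ (lp A ∞ ⧸ nullIdeal U A))

instance : CompleteSpace (Ultraproduct U A) :=
  inferInstanceAs (CompleteSpace (lp A ∞ ⧸ nullIdeal U A))

/-- The class of a bounded family in the ultraproduct. -/
def Ultraproduct.mk : lp A ∞ →ₐ[ℂ] Ultraproduct U A := Ideal.Quotient.mkₐ ℂ (nullIdeal U A)

variable {A}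

theorem Ultraproduct.mk_surjective : Function.Surjective (Ultraproduct.mk U A) :=
  Ideal.Quotient.mk_surjective

theorem star_mem_nullIdeal {f : lp A ∞} (hf : f ∈ nullIdeal U A) : star f ∈ nullIdeal U A := by
  rw [mem_nullIdeal] at hf ⊢
  simpa using hf

instance : Star (Ultraproduct U A) where
  star := Ideal.quotientMap (nullIdeal U A) (starRingEnd (lp A ∞)) fun _ => star_mem_nullIdeal U

theorem Ultraproduct.star_mk (f : lp A ∞) :
    star (Ultraproduct.mk U A f) = Ultraproduct.mk U A (star f) := rfl

instance : StarRing (Ultraproduct U A) where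
  star_involutive x := by
    obtain ⟨f, rfl⟩ := Ultraproduct.mk_surjective U x
    simp only [Ultraproduct.star_mk, star_star]
  star_mul x y := by
    obtain ⟨f, rfl⟩ := Ultraproduct.mk_surjective U x
    obtain ⟨g, rfl⟩ := Ultraproduct.mk_surjective U y
    simp only [Ultraproduct.star_mk, ← map_mul, star_mul]
  star_add x y := by
    obtain ⟨f, rfl⟩ := Ultraproduct.mk_surjective U x
    obtain ⟨g, rfl⟩ := Ultraproduct.mk_surjective U y
    simp only [Ultraproduct.star_mk, ← map_add, star_add]

instance : StarModule ℂ (Ultraproduct U A) where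
  star_smul c x := by
    obtain ⟨f, rfl⟩ := Ultraproduct.mk_surjective U x
    simp only [Ultraproduct.star_mk, ← map_smul, star_smul]

instance : CStarRing (Ultraproduct U A) where
  norm_mul_self_le x := by
    obtain ⟨f, rfl⟩ := Ultraproduct.mk_surjective U x
    refine le_of_forall_gt fun r hr => ?_
    obtain ⟨s, hs, hsr⟩ := exists_between hr
    have hs0 : 0 ≤ s := (norm_nonneg _).trans hs.le
    rw [Ultraproduct.star_mk, ← map_mul] at hs
    have h := eventually_lt_of_norm_mk_lt U hs
    have h' : ‖Ultraproduct.mk U A f‖ ≤ √s := by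
      refine norm_mk_le U (Real.sqrt_nonneg s) ?_
      filter_upwards [h] with i hi
      have hi' : ‖star (f i) * f i‖ < s := hi
      rw [CStarRing.norm_star_mul_self] at hi'
      exact Real.le_sqrt_of_sq_le (by nlinarith)
    calc ‖Ultraproduct.mk U A f‖ * ‖Ultraproduct.mk U A f‖ ≤ √s * √s := by gcongr
      _ = s := Real.mul_self_sqrt hs0
      _ < r := hsr

instance : CommCStarAlgebra (Ultraproduct U A) where

/-- The coordinatewise action of automorphisms on bounded families. -/
def familyMap (σ : ∀ i, A i ≃⋆ₐ[ℂ] A i) : lp A ∞ →+* lp A ∞ where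
  toFun f := ⟨fun i => σ i (f i), memℓp_infty ⟨‖f‖, by
    rintro _ ⟨i, rfl⟩
    simpa only [StarAlgEquiv.norm_map] using lp.norm_apply_le_norm (by simp) f i⟩⟩
  map_one' := by ext i; exact map_one (σ i)
  map_zero' := by ext i; exact map_zero (σ i)
  map_mul' f g := by ext i; exact map_mul (σ i) (f i) (g i)
  map_add' f g := by ext i; exact map_add (σ i) (f i) (g i)

theorem familyMap_apply (σ : ∀ i, A i ≃⋆ₐ[ℂ] A i) (f : lp A ∞) (i : ι) :
    familyMap σ f i = σ i (f i) := rfl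

theorem familyMap_mem (σ : ∀ i, A i ≃⋆ₐ[ℂ] A i) {f : lp A ∞} (hf : f ∈ nullIdeal U A) :
    familyMap σ f ∈ nullIdeal U A := by
  rw [mem_nullIdeal] at hf ⊢
  simpa only [familyMap_apply, StarAlgEquiv.norm_map] using hf

/-- The map induced on the ultraproduct by a family of automorphisms. -/
def ultraMap (σ : ∀ i, A i ≃⋆ₐ[ℂ] A i) : Ultraproduct U A →+* Ultraproduct U A :=
  Ideal.quotientMap (nullIdeal U A) (familyMap σ) fun _ => familyMap_mem U σ

theorem ultraMap_mk (σ : ∀ i, A i ≃⋆ₐ[ℂ] A i) (f : lp A ∞) :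
    ultraMap U σ (Ultraproduct.mk U A f) = Ultraproduct.mk U A (familyMap σ f) := rfl

/-- The automorphism `[(fᵢ)] ↦ [(σᵢ(fᵢ))]` of the ultraproduct. -/
def ultraAut (σ : ∀ i, A i ≃⋆ₐ[ℂ] A i) : Ultraproduct U A ≃⋆ₐ[ℂ] Ultraproduct U A where
  toFun := ultraMap U σ
  invFun := ultraMap U fun i => (σ i).symm
  left_inv x := by
    obtain ⟨f, rfl⟩ := Ultraproduct.mk_surjective U x
    rw [ultraMap_mk, ultraMap_mk]
    congr 1
    ext i
    exact (σ i).symm_apply_apply (f i)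
  right_inv x := by
    obtain ⟨f, rfl⟩ := Ultraproduct.mk_surjective U x
    rw [ultraMap_mk, ultraMap_mk]
    congr 1
    ext i
    exact (σ i).apply_symm_apply (f i)
  map_mul' := map_mul _
  map_add' := map_add _
  map_star' x := by
    obtain ⟨f, rfl⟩ := Ultraproduct.mk_surjective U x
    rw [Ultraproduct.star_mk, ultraMap_mk, ultraMap_mk, Ultraproduct.star_mk]
    congr 1
    ext i
    exact map_star (σ i) (f i)
  map_smul' c x := by
    obtain ⟨f, rfl⟩ := Ultraproduct.mk_surjective U x
    rw [← map_smul, ultraMap_mk, ultraMap_mk, ← map_smul]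
    congr 1
    ext i
    exact map_smul (σ i) c (f i)

end Ultraproduct

instance (p : Nat.Primes) : Nonempty (ℕ → Fin (p : ℕ)) := ⟨fun _ => ⟨0, p.2.pos⟩⟩

/-- The automorphism of the ultraproduct `∏_U C(X_p)` over the primes `p` of the structures of the
`p`-adic odometers. -/
def primeUltraAut (U : Ultrafilter Nat.Primes) :
    Ultraproduct U (fun p : Nat.Primes => C(ℕ → Fin (p : ℕ), ℂ)) ≃⋆ₐ[ℂ]
      Ultraproduct U (fun p : Nat.Primes => C(ℕ → Fin (p : ℕ), ℂ)) :=
  ultraAut U fun p => pOdometerAut p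

end CStarDyn

end

/-!
If `S` permutes a clopen partition of `X` in one cycle of length `a`, then the indicator function
`f` of a member of the partition satisfies `f² = f` and `f + σ f + ⋯ + σ^(a - 1) f = 1`. These
equations are preserved by elementary embeddings. A solution in an ultraproduct of structures
`(C(X i), S i)` solves them approximately in almost every factor, and rounding to the values `0` and
`1` makes the solution exact: almost every `S i` has a clopen cycle of length `a`. The iterates of
the `p`-adic odometer along suitable powers of `p` converge to the identity, and if `p` is coprime
to `a` these powers can be taken to be `1` modulo `a`; hence a clopen cycle of length `a` forces
`a = 1`. Along a nonprincipal ultrafilter almost all primes are coprime to `a`, so neither the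
ultraproduct nor its elementary substructures have a cycle of length at least `2`, while every
odometer has one. The theorems of Łoś and of Löwenheim and Skolem supply a separable structure of
this kind which satisfies everything that is true in all `p`-adic odometers.
-/

noncomputable section

namespace CStarDyn

section Real

variable {ι : Type*} {f g : ι → ℝ} {ε : ℝ}

theorem bddAbove_range_of_abs_sub_le (h : ∀ i, |f i - g i| ≤ ε) (hf : BddAbove (Set.range f)) :
    BddAbove (Set.range g) := by
  obtain ⟨M, hM⟩ := hf
  refine ⟨M + ε, Set.forall_mem_range.2 fun i => ?_⟩
  linarith [hM ⟨i, rfl⟩, (abs_le.1 (h i)).1]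

theorem iSup_sub_iSup_le_of_abs_sub_le [Nonempty ι] (h : ∀ i, |f i - g i| ≤ ε)
    (hg : BddAbove (Set.range g)) : (⨆ i, f i) - ⨆ i, g i ≤ ε := by
  rw [sub_le_iff_le_add]
  refine ciSup_le fun i => ?_
  linarith [le_ciSup hg i, (abs_le.1 (h i)).2]

theorem abs_iSup_sub_iSup_le (hε : 0 ≤ ε) (h : ∀ i, |f i - g i| ≤ ε) :
    |(⨆ i, f i) - ⨆ i, g i| ≤ ε := by
  have h' : ∀ i, |g i - f i| ≤ ε := fun i => abs_sub_comm (f i) (g i) ▸ h i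
  rcases isEmpty_or_nonempty ι with hι | hι
  · simpa using hε
  by_cases hf : BddAbove (Set.range f)
  · have hg := bddAbove_range_of_abs_sub_le h hf
    rw [abs_sub_le_iff]
    exact ⟨iSup_sub_iSup_le_of_abs_sub_le h hg, iSup_sub_iSup_le_of_abs_sub_le h' hf⟩
  · have hg := mt (bddAbove_range_of_abs_sub_le h') hf
    -- Both suprema have the junk value `0`.
    simpa only [Real.iSup_of_not_bddAbove hf, Real.iSup_of_not_bddAbove hg, sub_self, abs_zero]

end Real

section Assignments

variable {A : Type*} [SeminormedAddCommGroup A] {n : ℕ} {v w : Fin n → A} {x : A} {r R δ : ℝ}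

theorem norm_cons_le (hx : ‖x‖ ≤ r) (hv : ‖v‖ ≤ R) :
    ‖(Fin.cons x v : Fin (n + 1) → A)‖ ≤ max R r := by
  rw [pi_norm_le_iff_of_nonneg (le_max_of_le_left ((norm_nonneg v).trans hv))]
  exact Fin.cases (le_max_of_le_right hx) fun i =>
    le_max_of_le_left ((norm_le_pi_norm v i).trans hv)

theorem norm_cons_sub_cons_le (h : ‖v - w‖ ≤ δ) :
    ‖(Fin.cons x v : Fin (n + 1) → A) - Fin.cons x w‖ ≤ δ := by
  have hδ := (norm_nonneg _).trans h
  rw [pi_norm_le_iff_of_nonneg hδ]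
  refine Fin.cases ?_ fun i => ?_
  · simpa using hδ
  · simpa using (norm_le_pi_norm (v - w) i).trans h

instance (r : ℕ) : Nonempty (Metric.closedBall (0 : A) r) := ⟨⟨0, by simp⟩⟩

theorem norm_le_of_ball {r : ℕ} (x : Metric.closedBall (0 : A) r) : ‖(x : A)‖ ≤ r :=
  mem_closedBall_zero_iff.1 x.2

end Assignments

theorem norm_le_of_forall_abs_le {k : ℕ} {M x : Fin k → ℝ} (h : ∀ i, |x i| ≤ M i) : ‖x‖ ≤ ‖M‖ :=
  (pi_norm_le_iff_of_nonneg (norm_nonneg _)).2 fun i =>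
    (h i).trans ((le_abs_self _).trans (norm_le_pi_norm M i))

section Naturality

variable {A B : Type*} [CommCStarAlgebra A] [CommCStarAlgebra B] {σ : A ≃⋆ₐ[ℂ] A}
  {τ : B ≃⋆ₐ[ℂ] B} {n : ℕ}

theorem Term.eval_map {j : A →⋆ₐ[ℂ] B} (hj : Function.Semiconj j σ τ) (t : Term n)
    (v : Fin n → A) : j (t.eval σ v) = t.eval τ fun i => j (v i) := by
  induction t with
  | var i => rfl
  | zero => exact map_zero j
  | one => exact map_one j
  | plus s t hs ht => simp only [Term.eval, map_add, hs, ht]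
  | times s t hs ht => simp only [Term.eval, map_mul, hs, ht]
  | smul c t ht => simp only [Term.eval, map_smul, ht]
  | adj t ht => simp only [Term.eval, map_star, ht]
  | aut t ht => simp only [Term.eval, hj.eq, ht]

end Naturality

section Bounded

variable {ι : Type*} {A : ι → Type*} [∀ i, CommCStarAlgebra (A i)] [∀ i, Nontrivial (A i)]

/-- The coordinatewise automorphism of the C⋆-algebra of bounded families. -/
def familyAut (σ : ∀ i, A i ≃⋆ₐ[ℂ] A i) : lp A ∞ ≃⋆ₐ[ℂ] lp A ∞ where
  toFun := familyMap σ
  invFun := familyMap fun i => (σ i).symm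
  left_inv f := by ext i; exact (σ i).symm_apply_apply (f i)
  right_inv f := by ext i; exact (σ i).apply_symm_apply (f i)
  map_mul' := map_mul _
  map_add' := map_add _
  map_star' f := by ext i; exact map_star (σ i) (f i)
  map_smul' c f := by ext i; exact map_smul (σ i) c (f i)

variable (A) in
/-- The projection of the C⋆-algebra of bounded families to one coordinate. -/
def familyEval (i : ι) : lp A ∞ →⋆ₐ[ℂ] A i where
  toFun f := f i
  map_one' := rfl
  map_mul' _ _ := rfl
  map_zero' := rfl
  map_add' _ _ := rfl
  commutes' _ := rfl
  map_star' _ := rfl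

variable (σ : ∀ i, A i ≃⋆ₐ[ℂ] A i)

theorem semiconj_familyEval (i : ι) :
    Function.Semiconj (familyEval A i) (familyAut σ) (σ i) := fun _ => rfl

theorem Term.eval_familyAut {n : ℕ} (t : Term n) (v : Fin n → lp A ∞) (i : ι) :
    t.eval (familyAut σ) v i = t.eval (σ i) fun k => v k i :=
  t.eval_map (semiconj_familyEval σ i) v

variable (U : Ultrafilter ι)

variable (A) in
/-- The quotient map from the bounded families to the ultraproduct. -/
def Ultraproduct.mkStar : lp A ∞ →⋆ₐ[ℂ] Ultraproduct U A where
  __ := Ultraproduct.mk U A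
  map_star' f := (Ultraproduct.star_mk U f).symm

theorem semiconj_mkStar :
    Function.Semiconj (Ultraproduct.mkStar A U) (familyAut σ) (ultraAut U σ) := fun _ => rfl

theorem Term.eval_ultraAut {n : ℕ} (t : Term n) (v : Fin n → lp A ∞) :
    t.eval (ultraAut U σ) (fun k => Ultraproduct.mk U A (v k)) =
      Ultraproduct.mk U A (t.eval (familyAut σ) v) :=
  (t.eval_map (semiconj_mkStar σ U) v).symm

end Bounded

section Ball

variable {A : Type*} [CommCStarAlgebra A] [Nontrivial A] {n : ℕ} {R : ℝ}

variable (A n R) in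
/-- The coordinate functions on the ball of radius `R` in `Aⁿ`, as bounded families. Evaluating a
term at them turns statements that are uniform on the ball into statements about one point. -/
def ballCoord (k : Fin n) : lp (fun _ : Metric.closedBall (0 : Fin n → A) R => A) ∞ :=
  ⟨fun v => (v : Fin n → A) k, memℓp_infty ⟨R, Set.forall_mem_range.2 fun v =>
    (norm_le_pi_norm _ k).trans (mem_closedBall_zero_iff.1 v.2)⟩⟩

theorem Term.eval_ballCoord (σ : A ≃⋆ₐ[ℂ] A) (t : Term n)
    (v : Metric.closedBall (0 : Fin n → A) R) :
    t.eval (familyAut fun _ => σ) (ballCoord A n R) v = t.eval σ v :=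
  t.eval_familyAut (fun _ => σ) _ v

end Ball

section Bounds

variable {A : Type*} [CommCStarAlgebra A] (σ : A ≃⋆ₐ[ℂ] A) {n : ℕ}

theorem Term.exists_bound (t : Term n) (R : ℝ) : ∃ M, ∀ v, ‖v‖ ≤ R → ‖t.eval σ v‖ ≤ M := by
  rcases subsingleton_or_nontrivial A with h | h
  · exact ⟨0, fun v _ => (norm_of_subsingleton _).le⟩
  · refine ⟨‖t.eval (familyAut fun _ => σ) (ballCoord A n R)‖, fun v hv => ?_⟩
    rw [← t.eval_ballCoord σ ⟨v, mem_closedBall_zero_iff.2 hv⟩]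
    exact lp.norm_apply_le_norm ENNReal.top_ne_zero _ _

/-- The connective `x ↦ -x`. -/
def Formula.neg (φ : Formula n) : Formula n :=
  .conn ⟨fun x : Fin 1 → ℝ => -x 0, by fun_prop⟩ fun _ => φ

theorem Formula.eval_neg (φ : Formula n) (v : Fin n → A) : φ.neg.eval σ v = -φ.eval σ v := rfl

theorem Formula.eval_inf (r : ℕ) (φ : Formula (n + 1)) (v : Fin n → A) :
    (Formula.inf r φ).eval σ v = -(Formula.sup r φ.neg).eval σ v := by
  simp only [Formula.eval, Formula.eval_neg, iInf, iSup, Real.sInf_def, ← Set.image_neg_eq_neg,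
    ← Set.range_comp, Function.comp_def]

theorem Formula.abs_eval_sup_le {φ : Formula (n + 1)} {r : ℕ} {v : Fin n → A} {M : ℝ}
    (h : ∀ x : A, ‖x‖ ≤ r → |φ.eval σ (Fin.cons x v)| ≤ M) :
    |(Formula.sup r φ).eval σ v| ≤ M := by
  have hM : 0 ≤ M := (abs_nonneg _).trans (h 0 (by simp))
  have h0 : ∀ x : Metric.closedBall (0 : A) r, |φ.eval σ (Fin.cons (x : A) v) - 0| ≤ M :=
    fun x => by simpa only [sub_zero] using h x (norm_le_of_ball x)
  simpa only [Formula.eval, ciSup_const, sub_zero] using abs_iSup_sub_iSup_le hM h0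

theorem Formula.exists_bound (φ : Formula n) (R : ℝ) :
    ∃ M, ∀ v, ‖v‖ ≤ R → |φ.eval σ v| ≤ M := by
  induction φ generalizing R with
  | normOf t => simpa only [Formula.eval, abs_norm] using t.exists_bound σ R
  | conn u φ ih =>
    choose M h using fun i => ih i R
    obtain ⟨N, hN⟩ := (isCompact_closedBall (0 : Fin _ → ℝ) ‖M‖).exists_bound_of_continuousOn
      u.continuous.continuousOn
    exact ⟨N, fun v hv => hN _ (mem_closedBall_zero_iff.2
      (norm_le_of_forall_abs_le fun i => h i v hv))⟩
  | sup r φ ih =>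
    obtain ⟨M, h⟩ := ih (max R r)
    exact ⟨M, fun v hv => abs_eval_sup_le σ fun x hx => h _ (norm_cons_le hx hv)⟩
  | inf r φ ih =>
    obtain ⟨M, h⟩ := ih (max R r)
    refine ⟨M, fun v hv => ?_⟩
    rw [Formula.eval_inf, abs_neg]
    refine abs_eval_sup_le σ fun x hx => ?_
    rw [Formula.eval_neg, abs_neg]
    exact h _ (norm_cons_le hx hv)

variable (φ : Formula (n + 1)) (r : ℕ) (v : Fin n → A)

theorem Formula.bddAbove_eval_cons :
    BddAbove (Set.range fun x : Metric.closedBall (0 : A) r => φ.eval σ (Fin.cons (x : A) v)) := by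
  obtain ⟨M, h⟩ := φ.exists_bound σ (max ‖v‖ r)
  exact ⟨M, Set.forall_mem_range.2 fun x =>
    (le_abs_self _).trans (h _ (norm_cons_le (norm_le_of_ball x) le_rfl))⟩

theorem Formula.exists_lt_eval {ε : ℝ} (hε : 0 < ε) :
    ∃ x : A, ‖x‖ ≤ r ∧ (Formula.sup r φ).eval σ v - ε < φ.eval σ (Fin.cons x v) := by
  obtain ⟨x, hx⟩ := exists_lt_of_lt_ciSup (sub_lt_self ((Formula.sup r φ).eval σ v) hε)
  exact ⟨x, norm_le_of_ball x, hx⟩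

variable {φ r v}

theorem Formula.le_eval_sup {x : A} (hx : ‖x‖ ≤ r) :
    φ.eval σ (Fin.cons x v) ≤ (Formula.sup r φ).eval σ v :=
  le_ciSup (φ.bddAbove_eval_cons σ r v) ⟨x, mem_closedBall_zero_iff.2 hx⟩

theorem Formula.eval_sup_le {c : ℝ} (h : ∀ x : A, ‖x‖ ≤ r → φ.eval σ (Fin.cons x v) ≤ c) :
    (Formula.sup r φ).eval σ v ≤ c :=
  ciSup_le fun x => h x (norm_le_of_ball x)

end Bounds

theorem exists_norm_le_norm_sub_le {E : Type*} [NormedAddCommGroup E] [NormedSpace ℝ E] {r : ℝ}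
    (hr : 0 ≤ r) (a : E) : ∃ b : E, ‖b‖ ≤ r ∧ ‖b - a‖ ≤ max 0 (‖a‖ - r) := by
  rcases le_or_gt ‖a‖ r with h | h
  · exact ⟨a, h, by simp⟩
  have ha : 0 < ‖a‖ := hr.trans_lt h
  have hle : r / ‖a‖ - 1 ≤ 0 := sub_nonpos.2 (div_le_one_of_le₀ h.le ha.le)
  refine ⟨(r / ‖a‖) • a, ?_, le_max_of_le_right (Eq.le ?_)⟩
  · rw [norm_smul, Real.norm_of_nonneg (by positivity), div_mul_cancel₀ _ ha.ne']
  · calc ‖(r / ‖a‖) • a - a‖ = ‖(r / ‖a‖ - 1) • a‖ := by rw [sub_smul, one_smul]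
      _ = ‖a‖ - r := by
        rw [norm_smul, Real.norm_of_nonpos hle, neg_sub, sub_mul, one_mul,
          div_mul_cancel₀ _ ha.ne']

theorem IsElementaryEmbedding.models {A B : Type*} [CommCStarAlgebra A] [CommCStarAlgebra B]
    {σ : A ≃⋆ₐ[ℂ] A} {τ : B ≃⋆ₐ[ℂ] B} {j : A →⋆ₐ[ℂ] B} (hj : IsElementaryEmbedding σ τ j)
    {T : Theory} (hT : Models τ T) : Models σ T := fun φ hφ => by
  rw [← hj 0 φ, Subsingleton.elim (fun i => j _) Fin.elim0, hT φ hφ]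

theorem IsElementaryEmbedding.semiconj {A B : Type*} [CommCStarAlgebra A] [CommCStarAlgebra B]
    {σ : A ≃⋆ₐ[ℂ] A} {τ : B ≃⋆ₐ[ℂ] B} {j : A →⋆ₐ[ℂ] B} (hj : IsElementaryEmbedding σ τ j) :
    Function.Semiconj j σ τ := by
  intro x
  have h := hj 2 (.normOf (.plus (.aut (.var 0)) (.smul (-1) (.var 1)))) ![x, σ x]
  simp only [Formula.eval, Term.eval, Matrix.cons_val, neg_smul, one_smul, add_neg_cancel,
    norm_zero, norm_eq_zero, add_neg_eq_zero] at h
  exact h.symm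

section Los

variable {ι : Type*} (U : Ultrafilter ι) {A : ι → Type*} [∀ i, CommCStarAlgebra (A i)]
  [∀ i, Nontrivial (A i)]

theorem Ultraproduct.tendsto_norm (f : lp A ∞) :
    Filter.Tendsto (fun i => ‖f i‖) U (𝓝 ‖Ultraproduct.mk U A f‖) := by
  refine tendsto_order.2 ⟨fun a ha => ?_, fun a ha => eventually_lt_of_norm_mk_lt U ha⟩
  rcases lt_or_ge a 0 with h | h
  · exact .of_forall fun i => h.trans_le (norm_nonneg _)
  · by_contra hcon
    rw [← Ultrafilter.eventually_not] at hcon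
    exact ha.not_ge (norm_mk_le U h (hcon.mono fun i hi => not_lt.1 hi))

theorem Ultraproduct.mk_eq_mk_iff {f g : lp A ∞} :
    Ultraproduct.mk U A f = Ultraproduct.mk U A g ↔
      Filter.Tendsto (fun i => ‖f i - g i‖) U (𝓝 0) :=
  Ideal.Quotient.eq (I := nullIdeal U A)

variable {U} in
theorem Ultraproduct.exists_mk_eq_of_norm_le {x : Ultraproduct U A} {r : ℝ} (hr : 0 ≤ r)
    (hx : ‖x‖ ≤ r) : ∃ f : lp A ∞, Ultraproduct.mk U A f = x ∧ ∀ i, ‖f i‖ ≤ r := by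
  obtain ⟨g, rfl⟩ := Ultraproduct.mk_surjective U x
  choose b hb hbg using fun i => exists_norm_le_norm_sub_le hr (g i)
  refine ⟨⟨b, memℓp_infty ⟨r, Set.forall_mem_range.2 hb⟩⟩, ?_, hb⟩
  rw [Ultraproduct.mk_eq_mk_iff]
  refine squeeze_zero (fun i => norm_nonneg _) hbg ?_
  have hlim := (tendsto_const_nhds (x := (0 : ℝ))).max
    ((Ultraproduct.tendsto_norm U g).sub_const r)
  rwa [max_eq_left (sub_nonpos.2 hx)] at hlim

variable (σ : ∀ i, A i ≃⋆ₐ[ℂ] A i) {n : ℕ}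

theorem Formula.tendsto_eval_sup (r : ℕ) {φ : Formula (n + 1)} {f : Fin n → lp A ∞}
    (h : ∀ x : lp A ∞, Filter.Tendsto (fun i => φ.eval (σ i) (Fin.cons (x i) fun k => f k i)) U
      (𝓝 (φ.eval (ultraAut U σ)
        (Fin.cons (Ultraproduct.mk U A x) fun k => Ultraproduct.mk U A (f k))))) :
    Filter.Tendsto (fun i => (Formula.sup r φ).eval (σ i) fun k => f k i) U
      (𝓝 ((Formula.sup r φ).eval (ultraAut U σ) fun k => Ultraproduct.mk U A (f k))) := by
  refine tendsto_order.2 ⟨fun a ha => ?_, fun b hb => ?_⟩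
  · obtain ⟨x, hx, hlt⟩ := φ.exists_lt_eval (ultraAut U σ) r _ (sub_pos.2 ha)
    obtain ⟨x, rfl, hxr⟩ := Ultraproduct.exists_mk_eq_of_norm_le r.cast_nonneg hx
    rw [sub_sub_cancel] at hlt
    filter_upwards [(h x).eventually_const_lt hlt] with i hi
    exact hi.trans_le (φ.le_eval_sup (σ i) (hxr i))
  · choose x hxr hlt using fun i =>
      φ.exists_lt_eval (σ i) r (fun k => f k i) (half_pos (sub_pos.2 hb))
    let y : lp A ∞ := ⟨x, memℓp_infty ⟨r, Set.forall_mem_range.2 hxr⟩⟩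
    have hy := φ.le_eval_sup (v := fun k => Ultraproduct.mk U A (f k)) (ultraAut U σ)
      (norm_mk_le U (f := y) r.cast_nonneg (.of_forall hxr))
    filter_upwards [(h y).eventually_lt_const (hy.trans_lt (left_lt_add_div_two.2 hb))] with i hi
    have hi' : φ.eval (σ i) (Fin.cons (x i) fun k => f k i) < _ := hi
    linarith [hlt i, hi']

/-- Łoś's theorem. -/
theorem Formula.tendsto_eval (φ : Formula n) (f : Fin n → lp A ∞) :
    Filter.Tendsto (fun i => φ.eval (σ i) fun k => f k i) U
      (𝓝 (φ.eval (ultraAut U σ) fun k => Ultraproduct.mk U A (f k))) := by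
  have cons_apply {n : ℕ} (x : lp A ∞) (f : Fin n → lp A ∞) (i : ι) :
      (fun k => (Fin.cons x f : Fin (n + 1) → lp A ∞) k i) = Fin.cons (x i) fun k => f k i :=
    Fin.comp_cons (fun g : lp A ∞ => g i) x f
  have cons_mk {n : ℕ} (x : lp A ∞) (f : Fin n → lp A ∞) :
      (fun k => Ultraproduct.mk U A ((Fin.cons x f : Fin (n + 1) → lp A ∞) k)) =
        Fin.cons (Ultraproduct.mk U A x) fun k => Ultraproduct.mk U A (f k) :=
    Fin.comp_cons (Ultraproduct.mk U A) x f
  induction φ with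
  | normOf t =>
    simp only [Formula.eval, ← Term.eval_familyAut, Term.eval_ultraAut]
    exact Ultraproduct.tendsto_norm U _
  | conn u φ ih => exact (u.continuous.tendsto _).comp (tendsto_pi_nhds.2 fun k => ih k f)
  | sup r φ ih =>
    refine Formula.tendsto_eval_sup U σ r fun x => ?_
    simpa only [cons_apply, cons_mk] using ih (Fin.cons x f)
  | inf r φ ih =>
    simp only [Formula.eval_inf]
    refine (Formula.tendsto_eval_sup U σ r fun x => ?_).neg
    simpa only [Formula.eval_neg, cons_apply, cons_mk] using (ih (Fin.cons x f)).neg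

theorem Models.ultraAut {T : Theory} (h : ∀ i, Models (σ i) T) : Models (ultraAut U σ) T := by
  intro φ hφ
  have hlim := φ.tendsto_eval U σ Fin.elim0
  simp only [Subsingleton.elim _ Fin.elim0, h _ φ hφ] at hlim
  exact tendsto_nhds_unique hlim tendsto_const_nhds

end Los

section UniformContinuity

variable {A : Type*} [CommCStarAlgebra A] (σ : A ≃⋆ₐ[ℂ] A) {n : ℕ}

theorem Formula.tendsto_eval_sub_eval [Nontrivial A] (φ : Formula n) {R : ℝ}
    {v w : ℕ → Fin n → A} (hv : ∀ m, ‖v m‖ ≤ R) (hw : ∀ m, ‖w m‖ ≤ R)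
    (h : Filter.Tendsto (fun m => ‖v m - w m‖) .atTop (𝓝 0)) :
    Filter.Tendsto (fun m => φ.eval σ (v m) - φ.eval σ (w m)) (Filter.hyperfilter ℕ) (𝓝 0) := by
  let U := Filter.hyperfilter ℕ
  let family (x : ℕ → Fin n → A) (hx : ∀ m, ‖x m‖ ≤ R) (k : Fin n) : lp (fun _ : ℕ => A) ∞ :=
    ⟨fun m => x m k, memℓp_infty ⟨R, Set.forall_mem_range.2 fun m =>
      (norm_le_pi_norm (x m) k).trans (hx m)⟩⟩
  have hvw : (fun k => Ultraproduct.mk U _ (family v hv k)) =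
      fun k => Ultraproduct.mk U _ (family w hw k) := by
    funext k
    rw [Ultraproduct.mk_eq_mk_iff]
    exact squeeze_zero (fun m => norm_nonneg _) (fun m => norm_le_pi_norm (v m - w m) k)
      (h.mono_left Nat.hyperfilter_le_atTop)
  have hv' := φ.tendsto_eval U (fun _ => σ) (family v hv)
  have hw' := φ.tendsto_eval U (fun _ => σ) (family w hw)
  rw [hvw] at hv'
  simpa only [sub_self] using hv'.sub hw'

/-- Formulas are uniformly continuous on balls: two bounded sequences of assignments that approach
each other agree in an ultrapower, so by Łoś's theorem a formula cannot separate them. -/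
theorem Formula.exists_forall_abs_sub_le (φ : Formula n) (R : ℝ) {ε : ℝ} (hε : 0 < ε) :
    ∃ δ > 0, ∀ v w : Fin n → A, ‖v‖ ≤ R → ‖w‖ ≤ R → ‖v - w‖ ≤ δ →
      |φ.eval σ v - φ.eval σ w| ≤ ε := by
  rcases subsingleton_or_nontrivial A with hA | hA
  · exact ⟨1, one_pos, fun v w _ _ _ => by rw [Subsingleton.elim v w]; simpa using hε.le⟩
  by_contra! hcon
  choose v w hv hw hvw hlt using fun m : ℕ =>
    hcon (1 / ((m : ℝ) + 1)) Nat.one_div_pos_of_nat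
  have h := φ.tendsto_eval_sub_eval σ hv hw (squeeze_zero (fun m => norm_nonneg _) hvw
    tendsto_one_div_add_atTop_nhds_zero_nat)
  obtain ⟨m, hm⟩ := (h.abs.eventually_lt_const (abs_zero.trans_lt hε)).exists
  exact (hlt m).not_gt hm

end UniformContinuity

section DenseSublanguage

open TopologicalSpace (denseSeq denseRange_denseSeq)

/-- The terms of depth at most `m` built from variables and countably many dense constants. -/
def denseTermsOfDepth (n : ℕ) : ℕ → Set (Term n)
  | 0 => Set.range Term.var ∪ Set.range fun i => Term.smul (denseSeq ℂ i) Term.one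
  | m + 1 => denseTermsOfDepth n m ∪
      Set.image2 Term.plus (denseTermsOfDepth n m) (denseTermsOfDepth n m) ∪
      Set.image2 Term.times (denseTermsOfDepth n m) (denseTermsOfDepth n m) ∪
      Term.adj '' denseTermsOfDepth n m ∪ Term.aut '' denseTermsOfDepth n m

/-- A countable set of terms, dense in the sense of `Term.eval_mem_closure`. -/
def denseTerms (n : ℕ) : Set (Term n) := ⋃ m, denseTermsOfDepth n m

/-- The formulas of depth at most `m` built from norms of dense terms, countably many dense
connectives and suprema. -/
def denseFormulasOfDepth : ℕ → ∀ n, Set (Formula n)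
  | 0, n => Formula.normOf '' denseTerms n
  | m + 1, n => denseFormulasOfDepth m n ∪
      (⋃ k : ℕ, Set.image2 Formula.conn (Set.range (denseSeq C(Fin k → ℝ, ℝ)))
        {φ | ∀ i, φ i ∈ denseFormulasOfDepth m n}) ∪
      ⋃ r : ℕ, Formula.sup r '' denseFormulasOfDepth m (n + 1)

/-- A countable set of formulas, dense in the sense of `Formula.approximable`. -/
def denseFormulas (n : ℕ) : Set (Formula n) := ⋃ m, denseFormulasOfDepth m n

theorem countable_denseTerms (n : ℕ) : (denseTerms n).Countable := by
  refine Set.countable_iUnion fun m => ?_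
  induction m with
  | zero => exact (Set.countable_range _).union (Set.countable_range _)
  | succ m ih =>
    exact (((ih.union (ih.image2 ih _)).union (ih.image2 ih _)).union (ih.image _)).union
      (ih.image _)

theorem countable_denseFormulas (n : ℕ) : (denseFormulas n).Countable := by
  refine Set.countable_iUnion fun m => ?_
  induction m generalizing n with
  | zero => exact (countable_denseTerms n).image _
  | succ m ih =>
    exact ((ih n).union (Set.countable_iUnion fun k => (Set.countable_range _).image2
      (Set.countable_pi fun _ => ih n) _)).union
      (Set.countable_iUnion fun r => (ih _).image _)

variable {n : ℕ}

theorem monotone_denseTermsOfDepth : Monotone (denseTermsOfDepth n) :=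
  monotone_nat_of_le_succ fun _ _ ht => .inl <| .inl <| .inl <| .inl ht

theorem monotone_denseFormulasOfDepth : Monotone fun m => denseFormulasOfDepth m n :=
  monotone_nat_of_le_succ fun _ _ hφ => .inl <| .inl hφ

theorem exists_mem_denseTermsOfDepth {s t : Term n} (hs : s ∈ denseTerms n)
    (ht : t ∈ denseTerms n) : ∃ m, s ∈ denseTermsOfDepth n m ∧ t ∈ denseTermsOfDepth n m := by
  obtain ⟨l, hl⟩ := Set.mem_iUnion.1 hs
  obtain ⟨m, hm⟩ := Set.mem_iUnion.1 ht
  exact ⟨max l m, monotone_denseTermsOfDepth (le_max_left l m) hl,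
    monotone_denseTermsOfDepth (le_max_right l m) hm⟩

theorem plus_mem_denseTerms {s t : Term n} (hs : s ∈ denseTerms n) (ht : t ∈ denseTerms n) :
    Term.plus s t ∈ denseTerms n := by
  obtain ⟨m, hs, ht⟩ := exists_mem_denseTermsOfDepth hs ht
  exact Set.mem_iUnion.2 ⟨m + 1, .inl <| .inl <| .inl <| .inr ⟨s, hs, t, ht, rfl⟩⟩

theorem times_mem_denseTerms {s t : Term n} (hs : s ∈ denseTerms n) (ht : t ∈ denseTerms n) :
    Term.times s t ∈ denseTerms n := by
  obtain ⟨m, hs, ht⟩ := exists_mem_denseTermsOfDepth hs ht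
  exact Set.mem_iUnion.2 ⟨m + 1, .inl <| .inl <| .inr ⟨s, hs, t, ht, rfl⟩⟩

theorem adj_mem_denseTerms {t : Term n} (ht : t ∈ denseTerms n) : t.adj ∈ denseTerms n := by
  obtain ⟨m, ht⟩ := Set.mem_iUnion.1 ht
  exact Set.mem_iUnion.2 ⟨m + 1, .inl <| .inr ⟨t, ht, rfl⟩⟩

theorem aut_mem_denseTerms {t : Term n} (ht : t ∈ denseTerms n) : t.aut ∈ denseTerms n := by
  obtain ⟨m, ht⟩ := Set.mem_iUnion.1 ht
  exact Set.mem_iUnion.2 ⟨m + 1, .inr ⟨t, ht, rfl⟩⟩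

theorem conn_mem_denseFormulas {k : ℕ} {u : C(Fin k → ℝ, ℝ)} {φ : Fin k → Formula n}
    (hu : u ∈ Set.range (denseSeq C(Fin k → ℝ, ℝ))) (hφ : ∀ i, φ i ∈ denseFormulas n) :
    Formula.conn u φ ∈ denseFormulas n := by
  choose m hm using fun i => Set.mem_iUnion.1 (hφ i)
  have hle (i : Fin k) : m i ≤ Finset.univ.sup m := Finset.le_sup (Finset.mem_univ i)
  exact Set.mem_iUnion.2 ⟨Finset.univ.sup m + 1, .inl <| .inr <| Set.mem_iUnion.2
    ⟨k, u, hu, φ, fun i => monotone_denseFormulasOfDepth (hle i) (hm i), rfl⟩⟩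

theorem sup_mem_denseFormulas (r : ℕ) {φ : Formula (n + 1)} (hφ : φ ∈ denseFormulas (n + 1)) :
    Formula.sup r φ ∈ denseFormulas n := by
  obtain ⟨m, hm⟩ := Set.mem_iUnion.1 hφ
  exact Set.mem_iUnion.2 ⟨m + 1, .inr <| Set.mem_iUnion.2 ⟨r, φ, hm, rfl⟩⟩

variable {A : Type*} [CommCStarAlgebra A] (σ : A ≃⋆ₐ[ℂ] A)

theorem smul_one_mem_closure_denseTerms (v : Fin n → A) (c : ℂ) :
    c • (1 : A) ∈ closure (Term.eval σ v '' denseTerms n) :=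
  map_mem_closure (f := fun c : ℂ => c • (1 : A)) (continuous_id.smul continuous_const)
    (denseRange_denseSeq ℂ c)
    (Set.forall_mem_range.2 fun i => ⟨_, Set.mem_iUnion.2 ⟨0, .inr ⟨i, rfl⟩⟩, rfl⟩)

theorem mul_mem_closure_denseTerms {v : Fin n → A} {a b : A}
    (ha : a ∈ closure (Term.eval σ v '' denseTerms n))
    (hb : b ∈ closure (Term.eval σ v '' denseTerms n)) :
    a * b ∈ closure (Term.eval σ v '' denseTerms n) := by
  refine map_mem_closure₂ continuous_mul ha hb ?_
  rintro _ ⟨s, hs, rfl⟩ _ ⟨t, ht, rfl⟩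
  exact ⟨_, times_mem_denseTerms hs ht, rfl⟩

theorem Term.eval_mem_closure (t : Term n) (v : Fin n → A) :
    t.eval σ v ∈ closure (Term.eval σ v '' denseTerms n) := by
  induction t with
  | var i => exact subset_closure ⟨_, Set.mem_iUnion.2 ⟨0, .inl ⟨i, rfl⟩⟩, rfl⟩
  | zero => simpa only [Term.eval, zero_smul] using smul_one_mem_closure_denseTerms σ v 0
  | one => simpa only [Term.eval, one_smul] using smul_one_mem_closure_denseTerms σ v 1
  | plus s t hs ht =>
    rw [Term.eval]
    refine map_mem_closure₂ continuous_add hs ht ?_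
    rintro _ ⟨s, hs, rfl⟩ _ ⟨t, ht, rfl⟩
    exact ⟨_, plus_mem_denseTerms hs ht, rfl⟩
  | times s t hs ht => exact mul_mem_closure_denseTerms σ hs ht
  | smul c t ht =>
    rw [Term.eval, ← smul_one_mul]
    exact mul_mem_closure_denseTerms σ (smul_one_mem_closure_denseTerms σ v c) ht
  | adj t ht =>
    rw [Term.eval]
    refine map_mem_closure continuous_star ht ?_
    rintro _ ⟨t, ht, rfl⟩
    exact ⟨_, adj_mem_denseTerms ht, rfl⟩
  | aut t ht =>
    rw [Term.eval]
    refine map_mem_closure (StarAlgEquiv.isometry σ).continuous ht ?_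
    rintro _ ⟨t, ht, rfl⟩
    exact ⟨_, aut_mem_denseTerms ht, rfl⟩

theorem Term.exists_mem_denseTerms_norm_sub_le (t : Term n) (R : ℝ) {ε : ℝ} (hε : 0 < ε) :
    ∃ s ∈ denseTerms n, ∀ v, ‖v‖ ≤ R → ‖t.eval σ v - s.eval σ v‖ ≤ ε := by
  rcases subsingleton_or_nontrivial A with hA | hA
  · exact ⟨_, Set.mem_iUnion.2 ⟨0, .inr ⟨0, rfl⟩⟩, fun v _ => by
      simpa only [norm_of_subsingleton] using hε.le⟩
  · obtain ⟨_, ⟨s, hs, rfl⟩, hlt⟩ := Metric.mem_closure_iff.1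
      (t.eval_mem_closure (familyAut fun _ => σ) (ballCoord A n R)) ε hε
    refine ⟨s, hs, fun v hv => ?_⟩
    have hle := lp.norm_apply_le_norm ENNReal.top_ne_zero
      (t.eval (familyAut fun _ => σ) (ballCoord A n R) -
        s.eval (familyAut fun _ => σ) (ballCoord A n R)) ⟨v, mem_closedBall_zero_iff.2 hv⟩
    rw [lp.coeFn_sub, Pi.sub_apply, Term.eval_ballCoord, Term.eval_ballCoord] at hle
    rw [dist_eq_norm] at hlt
    exact hle.trans hlt.le

theorem exists_denseSeq_continuousMap_near {k : ℕ} (u : C(Fin k → ℝ, ℝ)) (R : ℝ) {ε : ℝ}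
    (hε : 0 < ε) : ∃ u' ∈ Set.range (denseSeq C(Fin k → ℝ, ℝ)), ∃ η > 0,
      ∀ x y : Fin k → ℝ, ‖x‖ ≤ R → ‖y‖ ≤ R → ‖x - y‖ ≤ η → |u x - u' y| ≤ ε := by
  have hK := isCompact_closedBall (0 : Fin k → ℝ) R
  have hu : ∀ᶠ u' in 𝓝 u, ∀ x ∈ Metric.closedBall 0 R, dist (u x) (u' x) < ε / 2 :=
    Metric.tendstoUniformlyOn_iff.1
      (ContinuousMap.tendsto_iff_forall_isCompact_tendstoUniformlyOn.1 Filter.tendsto_id _ hK) _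
      (half_pos hε)
  obtain ⟨u', hu'R, hu'⟩ :=
    (denseRange_denseSeq C(Fin k → ℝ, ℝ)).inter_nhds_nonempty hu
  obtain ⟨η, hη, h⟩ := Metric.uniformContinuousOn_iff_le.1
    (hK.uniformContinuousOn_of_continuous u.continuous.continuousOn) _ (half_pos hε)
  refine ⟨u', hu'R, η, hη, fun x y hx hy hxy => ?_⟩
  rw [← mem_closedBall_zero_iff] at hx hy
  have h1 := h x hx y hy (by rwa [dist_eq_norm])
  rw [← Real.dist_eq]
  linarith [dist_triangle (u x) (u y) (u' y), hu' y hy]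

/-- On every ball, the formula `φ` is a uniform limit of formulas of the countable dense
sublanguage. -/
def Formula.Approximable (φ : Formula n) : Prop :=
  ∀ R : ℝ, ∀ ε > 0, ∃ ψ ∈ denseFormulas n, ∀ v : Fin n → A, ‖v‖ ≤ R →
    |φ.eval σ v - ψ.eval σ v| ≤ ε

variable {σ}

theorem Formula.Approximable.conn {k : ℕ} (u : C(Fin k → ℝ, ℝ)) {φ : Fin k → Formula n}
    (h : ∀ i, (φ i).Approximable σ) : (Formula.conn u φ).Approximable σ := by
  intro R ε hε
  choose M hM using fun i => (φ i).exists_bound σ R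
  obtain ⟨u', hu', η, hη, hclose⟩ := exists_denseSeq_continuousMap_near u ‖fun i => M i + 1‖ hε
  choose ψ hψ hle using fun i => h i R (min 1 η) (lt_min one_pos hη)
  refine ⟨.conn u' ψ, conn_mem_denseFormulas hu' hψ, fun v hv => hclose _ _
    (norm_le_of_forall_abs_le fun i => ?_) (norm_le_of_forall_abs_le fun i => ?_)
    ((pi_norm_le_iff_of_nonneg hη.le).2 fun i => (hle i v hv).trans (min_le_right _ _))⟩
  · linarith [hM i v hv]
  · linarith [hM i v hv, (hle i v hv).trans (min_le_left _ _),
      abs_sub_abs_le_abs_sub ((ψ i).eval σ v) ((φ i).eval σ v),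
      abs_sub_comm ((ψ i).eval σ v) ((φ i).eval σ v)]

theorem Formula.Approximable.sup (r : ℕ) {φ : Formula (n + 1)} (h : φ.Approximable σ) :
    (Formula.sup r φ).Approximable σ := by
  intro R ε hε
  obtain ⟨ψ, hψ, hle⟩ := h (max R r) ε hε
  exact ⟨.sup r ψ, sup_mem_denseFormulas r hψ, fun v hv => abs_iSup_sub_iSup_le hε.le fun x =>
    hle _ (norm_cons_le (norm_le_of_ball x) hv)⟩

variable (σ)

theorem Formula.approximable (φ : Formula n) : φ.Approximable σ := by
  induction φ with
  | normOf t =>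
    intro R ε hε
    obtain ⟨s, hs, hle⟩ := t.exists_mem_denseTerms_norm_sub_le σ R hε
    exact ⟨.normOf s, Set.mem_iUnion.2 ⟨0, s, hs, rfl⟩, fun v hv =>
      (abs_norm_sub_norm_le _ _).trans (hle v hv)⟩
  | conn u φ ih => exact .conn u ih
  | sup r φ ih => exact ih.sup r
  | inf r φ ih =>
    have hneg : (Formula.sup r φ.neg).neg.Approximable σ :=
      .conn _ fun _ => .sup r (.conn _ fun _ => ih)
    simpa only [Formula.Approximable, Formula.eval_inf, Formula.eval_neg] using hneg

end DenseSublanguage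

section TarskiVaughtTest

variable {A B : Type*} [CommCStarAlgebra A] [CommCStarAlgebra B] {σ : A ≃⋆ₐ[ℂ] A}
  {τ : B ≃⋆ₐ[ℂ] B} {S : Set B}

variable (τ S) in
/-- The Tarski–Vaught criterion: suprema of formulas with parameters in `S` are approximated within
`S`. -/
def TarskiVaught : Prop :=
  ∀ (n : ℕ) (φ : Formula (n + 1)) (r : ℕ) (v : Fin n → B), (∀ i, v i ∈ S) → ∀ ε > 0,
    ∃ x ∈ S, ‖x‖ ≤ r ∧ (Formula.sup r φ).eval τ v - ε < φ.eval τ (Fin.cons x v)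

theorem TarskiVaught.eval_sup_eq {j : A →⋆ₐ[ℂ] B} (hj : Function.Injective j)
    (h : TarskiVaught τ (Set.range j)) (r : ℕ) {n : ℕ} {φ : Formula (n + 1)}
    (hφ : ∀ v : Fin (n + 1) → A, φ.eval τ (fun i => j (v i)) = φ.eval σ v) (v : Fin n → A) :
    (Formula.sup r φ).eval τ (fun i => j (v i)) = (Formula.sup r φ).eval σ v := by
  have hcons (x : A) : φ.eval τ (Fin.cons (j x) fun i => j (v i)) = φ.eval σ (Fin.cons x v) := by
    rw [← hφ (Fin.cons x v)]
    exact congrArg (φ.eval τ) (Fin.comp_cons j x v).symm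
  have hnorm (x : A) : ‖j x‖ = ‖x‖ := NonUnitalStarAlgHom.norm_map j hj x
  apply le_antisymm
  · refine le_of_forall_sub_le fun ε hε => ?_
    obtain ⟨_, ⟨x, rfl⟩, hx, hlt⟩ := h n φ r _ (fun i => ⟨v i, rfl⟩) ε hε
    rw [hnorm] at hx
    rw [hcons] at hlt
    exact hlt.le.trans (φ.le_eval_sup σ hx)
  · refine φ.eval_sup_le σ fun x hx => ?_
    rw [← hcons]
    exact φ.le_eval_sup τ ((hnorm x).trans_le hx)

theorem TarskiVaught.isElementaryEmbedding {j : A →⋆ₐ[ℂ] B} (hj : Function.Injective j)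
    (hjσ : Function.Semiconj j σ τ) (h : TarskiVaught τ (Set.range j)) :
    IsElementaryEmbedding σ τ j := by
  intro n φ
  induction φ with
  | normOf t =>
    intro v
    simp only [Formula.eval, ← t.eval_map hjσ]
    exact NonUnitalStarAlgHom.norm_map j hj _
  | conn u φ ih => exact fun v => congrArg u (funext fun i => ih i v)
  | sup r φ ih => exact h.eval_sup_eq hj r ih
  | inf r φ ih =>
    intro v
    simp only [Formula.eval_inf]
    exact congrArg Neg.neg (h.eval_sup_eq (φ := φ.neg) hj r (fun v => congrArg Neg.neg (ih v)) v)

theorem TarskiVaught.closure (h : TarskiVaught τ S) : TarskiVaught τ (closure S) := by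
  intro n φ r v hv ε hε
  have hε3 : 0 < ε / 3 := by positivity
  obtain ⟨δ, hδ, hδφ⟩ := φ.exists_forall_abs_sub_le τ (max (‖v‖ + 1) r) hε3
  choose w hwS hw using fun i =>
    Metric.mem_closure_iff.1 (hv i) (min δ 1) (lt_min hδ one_pos)
  have hvw : ‖v - w‖ ≤ min δ 1 :=
    (pi_norm_le_iff_of_nonneg (by positivity)).2 fun i => by
      rw [Pi.sub_apply, ← dist_eq_norm]; exact (hw i).le
  have hwR : ‖w‖ ≤ ‖v‖ + 1 := by
    linarith [norm_le_norm_add_norm_sub' w v, norm_sub_rev w v, min_le_right δ 1]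
  have hclose {x : B} (hx : ‖x‖ ≤ r) :
      |φ.eval τ (Fin.cons x v) - φ.eval τ (Fin.cons x w)| ≤ ε / 3 :=
    hδφ _ _ (norm_cons_le hx (by linarith)) (norm_cons_le hx hwR)
      (norm_cons_sub_cons_le (hvw.trans (min_le_left _ _)))
  have hsup : (Formula.sup r φ).eval τ v ≤ (Formula.sup r φ).eval τ w + ε / 3 :=
    φ.eval_sup_le τ fun x hx => by
      linarith [(abs_le.1 (hclose hx)).2, φ.le_eval_sup (v := w) τ hx]
  obtain ⟨x, hxS, hx, hlt⟩ := h n φ r w hwS _ hε3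
  exact ⟨x, subset_closure hxS, hx, by linarith [(abs_le.1 (hclose hx)).1]⟩

end TarskiVaughtTest

section Substructure

variable {B : Type*} [CommCStarAlgebra B] {τ : B ≃⋆ₐ[ℂ] B} {S : Set B}

theorem TarskiVaught.mem_of_term (h : TarskiVaught τ S) (hS : IsClosed S) {n : ℕ}
    (t : Term (n + 1)) {v : Fin n → B} (hv : ∀ i, v i ∈ S) {y : B}
    (hy : ∀ x, ‖t.eval τ (Matrix.vecCons x v)‖ = ‖x - y‖) : y ∈ S := by
  obtain ⟨r, hr⟩ := exists_nat_ge ‖y‖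
  rw [← hS.closure_eq, Metric.mem_closure_iff]
  intro ε hε
  obtain ⟨x, hxS, -, hlt⟩ := h n (Formula.normOf t).neg r v hv ε hε
  have heval (x : B) : (Formula.normOf t).neg.eval τ (Fin.cons x v) = -‖x - y‖ :=
    congrArg Neg.neg (hy x)
  have hsup := (Formula.normOf t).neg.le_eval_sup (v := v) τ hr
  rw [heval, sub_self, norm_zero, neg_zero] at hsup
  rw [heval] at hlt
  exact ⟨x, hxS, by rw [dist_comm, dist_eq_norm]; linarith⟩

/-- A closed set satisfying the Tarski–Vaught criterion, as a C⋆-subalgebra. -/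
def TarskiVaught.toStarSubalgebra (h : TarskiVaught τ S) (hS : IsClosed S) :
    StarSubalgebra ℂ B where
  carrier := S
  mul_mem' {a b} ha hb :=
    h.mem_of_term hS (.plus (.var 0) (.smul (-1) (.times (.var 1) (.var 2)))) (v := ![a, b])
      (Fin.forall_fin_two.2 ⟨ha, hb⟩) fun x => by
        simp only [Term.eval, Matrix.cons_val, neg_smul, one_smul, sub_eq_add_neg]
  add_mem' {a b} ha hb :=
    h.mem_of_term hS (.plus (.var 0) (.smul (-1) (.plus (.var 1) (.var 2)))) (v := ![a, b])
      (Fin.forall_fin_two.2 ⟨ha, hb⟩) fun x => by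
        simp only [Term.eval, Matrix.cons_val, neg_smul, one_smul, sub_eq_add_neg]
  algebraMap_mem' c :=
    h.mem_of_term hS (.plus (.var 0) (.smul (-c) .one)) (v := ![]) (fun i => i.elim0) fun x => by
      simp only [Term.eval, Matrix.cons_val, neg_smul, Algebra.algebraMap_eq_smul_one,
        sub_eq_add_neg]
  star_mem' {a} ha :=
    h.mem_of_term hS (.plus (.var 0) (.smul (-1) (.adj (.var 1)))) (v := ![a])
      (Fin.forall_fin_one.2 ha) fun x => by
        simp only [Term.eval, Matrix.cons_val, neg_smul, one_smul, sub_eq_add_neg]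

theorem TarskiVaught.map_mem (h : TarskiVaught τ S) (hS : IsClosed S) {a : B} (ha : a ∈ S) :
    τ a ∈ S :=
  h.mem_of_term hS (.plus (.var 0) (.smul (-1) (.aut (.var 1)))) (v := ![a])
    (Fin.forall_fin_one.2 ha) fun x => by
      simp only [Term.eval, Matrix.cons_val, neg_smul, one_smul, sub_eq_add_neg]

theorem TarskiVaught.symm_map_mem (h : TarskiVaught τ S) (hS : IsClosed S) {a : B}
    (ha : a ∈ S) : τ.symm a ∈ S :=
  h.mem_of_term hS (.plus (.aut (.var 0)) (.smul (-1) (.var 1))) (v := ![a])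
    (Fin.forall_fin_one.2 ha) fun x => by
      rw [← StarAlgEquiv.norm_map τ (x - _), map_sub, StarAlgEquiv.apply_symm_apply]
      simp only [Term.eval, Matrix.cons_val, neg_smul, one_smul, sub_eq_add_neg]

/-- The restriction of an automorphism to an invariant subalgebra. -/
def restrictAut (τ : B ≃⋆ₐ[ℂ] B) (S : StarSubalgebra ℂ B) (h : ∀ x ∈ S, τ x ∈ S)
    (h' : ∀ x ∈ S, τ.symm x ∈ S) : S ≃⋆ₐ[ℂ] S where
  toFun x := ⟨τ x, h x x.2⟩
  invFun x := ⟨τ.symm x, h' x x.2⟩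
  left_inv x := Subtype.ext (τ.symm_apply_apply x)
  right_inv x := Subtype.ext (τ.apply_symm_apply x)
  map_mul' x y := Subtype.ext (map_mul τ (x : B) y)
  map_add' x y := Subtype.ext (map_add τ (x : B) y)
  map_star' x := Subtype.ext (map_star τ (x : B))
  map_smul' c x := Subtype.ext (map_smul τ c (x : B))

end Substructure

section LowenheimSkolem

variable {B : Type*} [CommCStarAlgebra B] (τ : B ≃⋆ₐ[ℂ] B)

/-- The language of Skolem functions: for a formula of the dense sublanguage, a sort `r` and `k`, a
function that picks a point at which the formula is within `1 / (k + 1)` of its supremum over the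
ball of radius `r`. -/
def skolemLanguage : FirstOrder.Language where
  Functions n := denseFormulas (n + 1) × ℕ × ℕ
  Relations _ := Empty

/-- The interpretation of the Skolem functions. -/
abbrev skolemStructure : skolemLanguage.Structure B where
  funMap f v := (f.1.1.exists_lt_eval τ f.2.1 v (Nat.one_div_pos_of_nat (n := f.2.2))).choose
  RelMap r := r.elim

instance : Countable (Σ n, skolemLanguage.Functions n) :=
  have (n : ℕ) : Countable (skolemLanguage.Functions n) :=
    have := (countable_denseFormulas (n + 1)).to_subtype
    inferInstanceAs (Countable (denseFormulas (n + 1) × ℕ × ℕ))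
  inferInstance

theorem exists_countable_skolem_closed : ∃ D : Set B, D.Countable ∧
    ∀ (n : ℕ), ∀ ψ ∈ denseFormulas (n + 1), ∀ (r : ℕ) (v : Fin n → B), (∀ i, v i ∈ D) → ∀ ε > 0,
      ∃ x ∈ D, ‖x‖ ≤ r ∧ (Formula.sup r ψ).eval τ v - ε < ψ.eval τ (Fin.cons x v) := by
  let := skolemStructure τ
  let D := FirstOrder.Language.Substructure.closure skolemLanguage (∅ : Set B)
  refine ⟨D, Set.countable_empty.substructure_closure skolemLanguage, ?_⟩
  intro n ψ hψ r v hv ε hε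
  obtain ⟨k, hk⟩ := exists_nat_one_div_lt hε
  have h := (ψ.exists_lt_eval τ r v (Nat.one_div_pos_of_nat (n := k))).choose_spec
  exact ⟨_, D.fun_mem (⟨⟨ψ, hψ⟩, r, k⟩ : skolemLanguage.Functions n) v hv, h.1,
    (sub_le_sub_left hk.le _).trans_lt h.2⟩

theorem exists_countable_tarskiVaught : ∃ D : Set B, D.Countable ∧ TarskiVaught τ D := by
  obtain ⟨D, hD, h⟩ := exists_countable_skolem_closed τ
  refine ⟨D, hD, fun n φ r v hv ε hε => ?_⟩
  have hε3 : 0 < ε / 3 := by positivity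
  obtain ⟨ψ, hψ, hclose⟩ := φ.approximable τ (max ‖v‖ r) (ε / 3) hε3
  have hcons {x : B} (hx : ‖x‖ ≤ r) := abs_le.1 (hclose _ (norm_cons_le hx le_rfl))
  have hsup : (Formula.sup r φ).eval τ v ≤ (Formula.sup r ψ).eval τ v + ε / 3 :=
    φ.eval_sup_le τ fun x hx => by linarith [(hcons hx).2, ψ.le_eval_sup (v := v) τ hx]
  obtain ⟨x, hxD, hx, hlt⟩ := h n ψ hψ r v hv _ hε3
  exact ⟨x, hxD, hx, by linarith [(hcons hx).1]⟩

end LowenheimSkolem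

/-- The downward Löwenheim–Skolem theorem. -/
theorem exists_separable_elementary_substructure.{u} {B : Type u} [CommCStarAlgebra B]
    (τ : B ≃⋆ₐ[ℂ] B) :
    ∃ (A₀ : Type u) (_ : CommCStarAlgebra A₀) (_ : TopologicalSpace.SeparableSpace A₀)
      (σ₀ : A₀ ≃⋆ₐ[ℂ] A₀) (j : A₀ →⋆ₐ[ℂ] B), IsElementaryEmbedding σ₀ τ j := by
  obtain ⟨D, hD, h⟩ := exists_countable_tarskiVaught τ
  have hS : IsClosed (closure D) := isClosed_closure
  let S := h.closure.toStarSubalgebra hS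
  have : IsClosed (S : Set B) := hS
  have hsep : TopologicalSpace.IsSeparable (S : Set B) := hD.isSeparable.closure
  let σ₀ := restrictAut τ S (fun _ => h.closure.map_mem hS) fun _ => h.closure.symm_map_mem hS
  have hrange : Set.range S.subtype = closure D := Subtype.range_coe
  exact ⟨S, inferInstance, hsep.separableSpace, σ₀, S.subtype,
    TarskiVaught.isElementaryEmbedding Subtype.val_injective (fun _ => rfl)
      (hrange ▸ h.closure)⟩

section CyclicBase

variable {X : Type*} {S : X → X} {a : ℕ} {B : Set X}

theorem birkhoffSum_indicator_eq_one {x : X} {i : ℕ} (hi : i < a)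
    (h : ∀ k < a, S^[k] x ∈ B ↔ k = i) :
    birkhoffSum S (B.indicator 1) a x = (1 : ℤ) := by
  rw [birkhoffSum, Finset.sum_eq_single_of_mem i (Finset.mem_range.2 hi),
    Set.indicator_of_mem ((h i hi).2 rfl), Pi.one_apply]
  exact fun k hk hki => Set.indicator_of_notMem (mt (h k (Finset.mem_range.1 hk)).1 hki) _

variable [TopologicalSpace X]

/-- `B` is a clopen set whose preimages under `S^[0], …, S^[a - 1]` partition the space. The
partition is encoded by counting: exactly one of the points `x, S x, …, S^[a - 1] x` is in `B`. -/
def IsCyclicBase (S : X → X) (a : ℕ) (B : Set X) : Prop :=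
  IsClopen B ∧ ∀ x, birkhoffSum S (B.indicator 1) a x = (1 : ℤ)

theorem IsCyclicBase.preimage (hB : IsCyclicBase S a B) {Y : Type*} [TopologicalSpace Y]
    {R : Y → Y} {h : Y → X} (hc : Continuous h) (hR : Function.Semiconj h R S) :
    IsCyclicBase R a (h ⁻¹' B) := by
  refine ⟨hB.1.preimage hc, fun y => (Finset.sum_congr rfl fun k _ => ?_).trans (hB.2 (h y))⟩
  rw [← (hR.iterate_right k).eq]
  exact (Set.indicator_comp_right (g := (1 : X → ℤ)) h).symm

theorem IsCyclicBase.pos [Nonempty X] (hB : IsCyclicBase S a B) : 0 < a := by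
  obtain ⟨x⟩ := ‹Nonempty X›
  rcases Nat.eq_zero_or_pos a with rfl | ha
  · simpa only [birkhoffSum_zero, zero_ne_one] using hB.2 x
  · exact ha

theorem IsCyclicBase.iterate_mem_iff (hB : IsCyclicBase S a B) (x : X) : S^[a] x ∈ B ↔ x ∈ B := by
  have h := birkhoffSum_apply_sub_birkhoffSum S (B.indicator (1 : X → ℤ)) a x
  rw [hB.2, hB.2, sub_self, eq_comm, sub_eq_zero] at h
  by_cases hx : x ∈ B <;> by_cases hx' : S^[a] x ∈ B <;> simp_all

theorem IsCyclicBase.iterate_mem_iff_of_modEq (hB : IsCyclicBase S a B) {k l : ℕ}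
    (h : k ≡ l [MOD a]) (x : X) : S^[k] x ∈ B ↔ S^[l] x ∈ B := by
  have hmul (m : ℕ) (y : X) : S^[a * m] y ∈ B ↔ y ∈ B := by
    induction m with
    | zero => rfl
    | succ m ih =>
      rw [Nat.mul_succ, Nat.add_comm, Function.iterate_add_apply, hB.iterate_mem_iff, ih]
  have hmod (k : ℕ) : S^[k] x ∈ B ↔ S^[k % a] x ∈ B := by
    conv_lhs => rw [← Nat.div_add_mod k a, Function.iterate_add_apply, hmul]
  rw [hmod k, hmod l, h]

theorem IsCyclicBase.length_eq_one [Nonempty X] (hB : IsCyclicBase S a B) {k : ℕ → ℕ}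
    (hk : ∀ n, k n ≡ 1 [MOD a])
    (hS : ∀ x, Filter.Tendsto (fun n => S^[k n] x) Filter.atTop (𝓝 x)) : a = 1 := by
  have hinv (x : X) : S x ∈ B ↔ x ∈ B := by
    have hmem (n : ℕ) : S^[k n] x ∈ B ↔ S x ∈ B := hB.iterate_mem_iff_of_modEq (hk n) x
    constructor
    · exact fun h => hB.1.isClosed.mem_of_tendsto (hS x) (.of_forall fun n => (hmem n).2 h)
    · intro h
      obtain ⟨n, hn⟩ := ((hS x).eventually (hB.1.isOpen.mem_nhds h)).exists
      exact (hmem n).1 hn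
  have hcomp : B.indicator (1 : X → ℤ) ∘ S = B.indicator 1 := by
    funext x
    exact Set.indicator_eq_indicator (hinv x) rfl
  obtain ⟨x⟩ := ‹Nonempty X›
  have hsum := hB.2 x
  rw [birkhoffSum_of_comp_eq hcomp, Pi.smul_apply, nsmul_eq_mul] at hsum
  exact_mod_cast Int.eq_one_of_mul_eq_one_right (Int.natCast_nonneg a) hsum

end CyclicBase

section Odometer

variable {a : ℕ → ℕ} {k m n : ℕ}

theorem birkhoffSum_mul_of_comp_eq {X M : Type*} [AddCommMonoid M] {f : X → X} {g : X → M}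
    (h : g ∘ f^[n] = g) (m : ℕ) (x : X) :
    birkhoffSum f g (n * m) x = m • birkhoffSum f g n x := by
  have hshift : ∀ y, birkhoffSum f g n (f^[n] y) = birkhoffSum f g n y := fun y =>
    Finset.sum_congr rfl fun k _ => by
      rw [Function.Commute.iterate_iterate_self f k n y]
      exact congrFun h _
  induction m generalizing x with
  | zero => simp only [Nat.mul_zero, birkhoffSum_zero, zero_nsmul]
  | succ m ih => rw [Nat.mul_succ, Nat.add_comm, birkhoffSum_add, ih, hshift, succ_nsmul']

/-- The carry into the `n`-th digit when `1` is added to `b`. -/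
def carry (a : ℕ → ℕ) (n : ℕ) (b : ∀ n, Fin (a n)) : ℕ :=
  open Classical in if ∀ i < n, (b i : ℕ) + 1 = a i then 1 else 0

theorem carry_congr {b c : ∀ n, Fin (a n)} (h : ∀ i < n, b i = c i) :
    carry a n b = carry a n c := by
  have hiff : (∀ i < n, (b i : ℕ) + 1 = a i) ↔ ∀ i < n, (c i : ℕ) + 1 = a i :=
    forall₂_congr fun i hi => by rw [h i hi]
  simp only [carry, hiff]

theorem carry_zero (b : ∀ n, Fin (a n)) : carry a 0 b = 1 :=
  if_pos fun _ h => absurd h (Nat.not_lt_zero _)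

theorem odometer_modEq (b : ∀ n, Fin (a n)) (n : ℕ) :
    (odometer a b n : ℕ) ≡ b n + carry a n b [MOD a n] := by
  change (odometerFun a b n : ℕ) ≡ _ [MOD a n]
  unfold odometerFun carry
  split_ifs with h
  · exact Nat.mod_modEq _ _
  · rfl

theorem odometer_iterate_modEq (b : ∀ n, Fin (a n)) (n k : ℕ) :
    ((odometer a)^[k] b n : ℕ) ≡ b n + birkhoffSum (odometer a) (carry a n) k b [MOD a n] := by
  induction k with
  | zero => rfl
  | succ k ih =>
    rw [Function.iterate_succ_apply', birkhoffSum_succ, ← Nat.add_assoc]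
    exact (odometer_modEq _ n).trans (ih.add_right _)

theorem odometer_iterate_apply_of_dvd (hk : ∏ i ∈ Finset.range n, a i ∣ k)
    (b : ∀ n, Fin (a n)) : ∀ i < n, (odometer a)^[k] b i = b i := by
  induction n generalizing k b with
  | zero => simp only [Nat.not_lt_zero, false_imp_iff, implies_true]
  | succ n ih =>
    rw [Finset.prod_range_succ] at hk
    refine Nat.forall_lt_succ_right.2 ⟨ih (dvd_of_mul_right_dvd hk) b, ?_⟩
    obtain ⟨m, rfl⟩ := hk
    have hcarry : carry a n ∘ (odometer a)^[∏ i ∈ Finset.range n, a i] = carry a n :=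
      funext fun c => carry_congr (ih dvd_rfl c)
    have h := odometer_iterate_modEq b n ((∏ i ∈ Finset.range n, a i) * (a n * m))
    rw [birkhoffSum_mul_of_comp_eq hcarry, smul_eq_mul, Nat.mul_assoc (a n)] at h
    rw [Nat.mul_assoc]
    exact Fin.ext ((h.trans (Nat.add_modulus_mul_modEq_iff.2 rfl)).eq_of_lt_of_lt
      (Fin.isLt _) (b n).isLt)

theorem tendsto_odometer_iterate {k : ℕ → ℕ} (hk : ∀ n, ∏ i ∈ Finset.range n, a i ∣ k n)
    (b : ∀ n, Fin (a n)) :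
    Filter.Tendsto (fun n => (odometer a)^[k n] b) Filter.atTop (𝓝 b) := by
  refine tendsto_pi_nhds.2 fun i => tendsto_nhds_of_eventually_eq ?_
  filter_upwards [Filter.eventually_gt_atTop i] with n hn
  exact odometer_iterate_apply_of_dvd (hk n) b i hn

theorem IsCyclicBase.length_eq_one_of_coprime [Nonempty (∀ n, Fin (a n))]
    {B : Set (∀ n, Fin (a n))} (hB : IsCyclicBase (odometer a) m B)
    (hm : ∀ i, Nat.Coprime (a i) m) : m = 1 := by
  refine hB.length_eq_one (k := fun n => (∏ i ∈ Finset.range n, a i) ^ m.totient)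
    (fun n => Nat.ModEq.pow_totient (Nat.Coprime.prod_left fun i _ => hm i))
    (tendsto_odometer_iterate fun n => dvd_pow_self _ (Nat.totient_pos.2 hB.pos).ne')

theorem isCyclicBase_odometer (ha : 0 < a 0) :
    IsCyclicBase (odometer a) (a 0) {b | (b 0 : ℕ) = 0} := by
  refine ⟨(isClopen_discrete {i : Fin (a 0) | (i : ℕ) = 0}).preimage (continuous_apply 0),
    fun b => ?_⟩
  have hdigit (k : ℕ) : ((odometer a)^[k] b 0 : ℕ) = (b 0 + k) % a 0 := by
    have h := odometer_iterate_modEq b 0 k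
    rw [funext carry_zero] at h
    simpa [birkhoffSum, Nat.ModEq, Nat.mod_eq_of_lt (Fin.isLt _)] using h
  have hb := (b 0).isLt
  refine birkhoffSum_indicator_eq_one (i := (a 0 - b 0) % a 0) (Nat.mod_lt _ ha) fun k hk => ?_
  rw [Set.mem_ofPred_eq, hdigit]
  rcases Nat.eq_zero_or_pos (b 0 : ℕ) with h0 | h0
  · rw [h0, Nat.zero_add, Nat.sub_zero, Nat.mod_self, Nat.mod_eq_of_lt hk]
  · rw [Nat.mod_eq_of_lt (Nat.sub_lt ha h0)]
    rcases Nat.lt_or_ge (b 0 + k) (a 0) with h | h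
    · rw [Nat.mod_eq_of_lt h]; omega
    · rw [Nat.mod_eq_sub_mod h, Nat.mod_eq_of_lt (by omega)]; omega

theorem IsOdometer.exists_isCyclicBase {X : Type} [TopologicalSpace X] {S : X ≃ₜ X}
    (h : IsOdometer X S) : ∃ m ≥ 2, ∃ B, IsCyclicBase S m B := by
  obtain ⟨a, ha, h, hS⟩ := h
  exact ⟨a 0, ha 0, _, (isCyclicBase_odometer (two_pos.trans_le (ha 0))).preimage h.continuous hS⟩

end Odometer

section Partition

theorem bijOn_iterate_of_transitive {α : Type*} {f : α → α} {s : Set α} (hf : Set.MapsTo f s s)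
    (htrans : ∀ x ∈ s, ∀ y ∈ s, ∃ k, f^[k] x = y) {x : α} (hx : x ∈ s) :
    Set.BijOn (fun i => f^[i] x) (Set.Iio s.ncard) s := by
  have hper : 0 < Function.minimalPeriod f x := by
    obtain ⟨k, hk⟩ := htrans (f x) (hf hx) x hx
    exact Function.IsPeriodicPt.minimalPeriod_pos (n := k + 1) k.succ_pos hk
  have hbij : Set.BijOn (fun i => f^[i] x) (Set.Iio (Function.minimalPeriod f x)) s := by
    refine ⟨fun i _ => hf.iterate i hx, Function.iterate_injOn_Iio_minimalPeriod, fun y hy => ?_⟩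
    obtain ⟨k, rfl⟩ := htrans x hx y hy
    exact ⟨k % Function.minimalPeriod f x, Nat.mod_lt _ hper,
      Function.iterate_mod_minimalPeriod_eq⟩
  have hcard : s.ncard = Function.minimalPeriod f x := by
    rw [← hbij.image_eq, hbij.injOn.ncard_image, ← Nat.card_coe_set_eq]
    simp
  exact hcard ▸ hbij

variable {Y : Type*} [TopologicalSpace Y] {τ : Y → Y}

theorem isCyclicBase_of_partition {P : Set (Set Y)} (hdisj : P.PairwiseDisjoint id)
    (hcover : ⋃₀ P = Set.univ) (hmaps : ∀ C ∈ P, τ '' C ∈ P)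
    (htrans : ∀ C ∈ P, ∀ D ∈ P, ∃ k : ℕ, τ^[k] '' C = D) {B : Set Y} (hB : B ∈ P)
    (hclopen : IsClopen B) : IsCyclicBase τ P.ncard B := by
  refine ⟨hclopen, fun y => ?_⟩
  obtain ⟨C, hC, hy⟩ : y ∈ ⋃₀ P := hcover ▸ Set.mem_univ y
  simp only [Set.image_iterate_eq] at htrans
  have hbij := bijOn_iterate_of_transitive hmaps htrans hC
  have hmem (k : ℕ) : τ^[k] y ∈ (Set.image τ)^[k] C := by
    rw [← Set.image_iterate_eq]
    exact Set.mem_image_of_mem _ hy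
  obtain ⟨i, hi, rfl⟩ := hbij.surjOn hB
  refine birkhoffSum_indicator_eq_one hi fun k hk => ⟨fun hk' => hbij.injOn hk hi ?_, ?_⟩
  · exact hdisj.elim_set (hbij.mapsTo hk) hB _ (hmem k) hk'
  · rintro rfl
    exact hmem k

theorem HasOdometerPartitions.exists_isCyclicBase {τ : Y ≃ₜ Y} (h : HasOdometerPartitions τ) :
    ∃ a ≥ 2, ∃ B, IsCyclicBase τ a B := by
  obtain ⟨a, P, ha, -, hcard, hclopen, hdisj, hcover, -, hmaps, htrans⟩ := h
  have hlength : 2 ≤ (P 1).ncard := by simpa [hcard] using ha 0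
  obtain ⟨B, hB⟩ := Set.nonempty_of_ncard_ne_zero (two_pos.trans_le hlength).ne'
  exact ⟨_, hlength, B, isCyclicBase_of_partition (hdisj 1) (hcover 1) (hmaps 1) (htrans 1) hB
    (hclopen 1 B hB).1⟩

end Partition

section CyclicIdempotent

/-- `f` is an idempotent whose translates `f, σ f, …, σ^[a - 1] f` add up to `1`: the algebraic
counterpart, in `C(X)`, of a cyclic base of length `a`. -/
structure IsCyclicIdempotent {A : Type*} [Semiring A] (σ : A → A) (a : ℕ) (f : A) : Prop where
  isIdempotentElem : IsIdempotentElem f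
  sum_iterate : ∑ i ∈ Finset.range a, σ^[i] f = 1

theorem map_sum_iterate {A B F : Type*} [Semiring A] [Semiring B] [FunLike F A B]
    [RingHomClass F A B] {σ : A → A} {τ : B → B} {j : F} (hj : Function.Semiconj j σ τ) (a : ℕ)
    (f : A) : j (∑ i ∈ Finset.range a, σ^[i] f) = ∑ i ∈ Finset.range a, τ^[i] (j f) := by
  rw [map_sum]
  exact Finset.sum_congr rfl fun i _ => (hj.iterate_right i).eq f

theorem IsCyclicIdempotent.map {A B F : Type*} [Semiring A] [Semiring B] [FunLike F A B]
    [RingHomClass F A B] {σ : A → A} {τ : B → B} {j : F} (hj : Function.Semiconj j σ τ) {a : ℕ}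
    {f : A} (hf : IsCyclicIdempotent σ a f) : IsCyclicIdempotent τ a (j f) where
  isIdempotentElem := hf.isIdempotentElem.map j
  sum_iterate := by rw [← map_sum_iterate hj, hf.sum_iterate, map_one]

theorem intCast_birkhoffSum_indicator {X : Type*} {S : X → X} {a : ℕ} (B : Set X) (x : X) :
    ((birkhoffSum S (B.indicator 1) a x : ℤ) : ℂ) = birkhoffSum S (B.indicator 1) a x := by
  classical
  simp only [birkhoffSum, Set.indicator_apply, Pi.one_apply, Int.cast_sum, Int.cast_ite,
    Int.cast_one, Int.cast_zero]

variable {X : Type*} [TopologicalSpace X] [CompactSpace X] {S : X ≃ₜ X} {a : ℕ}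

theorem inducedAut_iterate_apply (k : ℕ) (f : C(X, ℂ)) (x : X) :
    (inducedAut S)^[k] f x = f (S^[k] x) := by
  induction k generalizing f with
  | zero => rfl
  | succ k ih => rw [Function.iterate_succ_apply, ih, Function.iterate_succ_apply']; rfl

theorem sum_inducedAut_iterate_apply (f : C(X, ℂ)) (x : X) :
    (∑ i ∈ Finset.range a, (inducedAut S)^[i] f) x = birkhoffSum S f a x := by
  simp only [ContinuousMap.sum_apply, inducedAut_iterate_apply, birkhoffSum]

theorem IsCyclicBase.exists_isCyclicIdempotent {B : Set X} (hB : IsCyclicBase S a B) :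
    ∃ f, IsCyclicIdempotent (inducedAut S) a f := by
  refine ⟨⟨B.indicator 1, hB.1.continuous_indicator continuous_const⟩, ?_, ?_⟩
  · ext x
    by_cases hx : x ∈ B <;> simp [hx]
  · ext x
    rw [sum_inducedAut_iterate_apply]
    exact (intCast_birkhoffSum_indicator B x).symm.trans (by rw [hB.2, Int.cast_one]; rfl)

end CyclicIdempotent

section Rounding

/-- The complex numbers which, if they are almost idempotent, are close to `1` rather than `0`. -/
def nearOne : Set ℂ := {z | 1 / 2 ≤ ‖z‖}

theorem norm_mul_self_sub_self (z : ℂ) : ‖z * z - z‖ = ‖z‖ * ‖z - 1‖ := by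
  rw [← norm_mul, mul_sub_one]

theorem one_sub_norm_le (z : ℂ) : 1 - ‖z‖ ≤ ‖z - 1‖ := by
  simpa only [norm_one, norm_sub_rev] using norm_sub_norm_le 1 z

theorem norm_sub_indicator_nearOne_le (z : ℂ) :
    ‖z - (nearOne.indicator 1 z : ℤ)‖ ≤ 2 * ‖z * z - z‖ := by
  have htri := one_sub_norm_le z
  rw [norm_mul_self_sub_self]
  by_cases h : z ∈ nearOne
  · have hz : 1 / 2 ≤ ‖z‖ := h
    rw [Set.indicator_of_mem h, Pi.one_apply, Int.cast_one]
    nlinarith [norm_nonneg (z - 1)]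
  · have hz : ‖z‖ < 1 / 2 := not_le.1 h
    rw [Set.indicator_of_notMem h, Int.cast_zero, sub_zero]
    nlinarith [norm_nonneg z]

variable {X : Type*} {f : X → ℂ} {ε : ℝ}

theorem isClopen_preimage_nearOne [TopologicalSpace X] (hf : Continuous f)
    (h : ∀ x, ‖f x * f x - f x‖ < 1 / 4) : IsClopen (f ⁻¹' nearOne) := by
  have hne (x : X) : 1 / 2 ≠ ‖f x‖ := by
    intro hx
    have hfx := h x
    rw [norm_mul_self_sub_self, ← hx] at hfx
    linarith [one_sub_norm_le (f x)]
  have hopen : f ⁻¹' nearOne = {x | 1 / 2 < ‖f x‖} := Set.ext fun x => (hne x).le_iff_lt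
  exact ⟨isClosed_le continuous_const hf.norm, hopen ▸ isOpen_lt continuous_const hf.norm⟩

theorem birkhoffSum_indicator_nearOne_eq_one {S : X → X} {a : ℕ}
    (hf : ∀ x, ‖f x * f x - f x‖ ≤ ε) (hε : (2 * a + 1) * ε < 1) {x : X}
    (hsum : ‖birkhoffSum S f a x - 1‖ ≤ ε) :
    birkhoffSum S ((f ⁻¹' nearOne).indicator 1) a x = (1 : ℤ) := by
  set m : ℤ := birkhoffSum S ((f ⁻¹' nearOne).indicator 1) a x with hm
  have hround : ‖birkhoffSum S f a x - m‖ ≤ a * (2 * ε) := by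
    rw [hm, birkhoffSum, birkhoffSum, Int.cast_sum, ← Finset.sum_sub_distrib]
    refine (norm_sum_le_of_le _ fun k _ => (norm_sub_indicator_nearOne_le _).trans
      (mul_le_mul_of_nonneg_left (hf _) zero_le_two)).trans_eq ?_
    rw [Finset.sum_const, Finset.card_range, nsmul_eq_mul]
  have hlt : ‖((m - 1 : ℤ) : ℂ)‖ < 1 := by
    have htri := norm_sub_le_norm_sub_add_norm_sub (m : ℂ) (birkhoffSum S f a x) 1
    rw [norm_sub_rev (m : ℂ) (birkhoffSum S f a x)] at htri
    push_cast
    linarith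
  rw [Complex.norm_intCast] at hlt
  exact sub_eq_zero.1 (Int.abs_lt_one_iff.1 (mod_cast hlt))

theorem isCyclicBase_of_approx [TopologicalSpace X] [CompactSpace X] {S : X ≃ₜ X} {a : ℕ}
    {f : C(X, ℂ)} (hε : ε * (4 * (a + 1)) ≤ 1) (hf : ‖f * f - f‖ < ε)
    (hsum : ‖∑ i ∈ Finset.range a, (inducedAut S)^[i] f - 1‖ < ε) :
    IsCyclicBase S a (f ⁻¹' nearOne) := by
  have hε0 : 0 < ε := (norm_nonneg _).trans_lt hf
  have ha : 0 ≤ ε * a := mul_nonneg hε0.le a.cast_nonneg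
  have hfx (x : X) : ‖f x * f x - f x‖ < ε := ((f * f - f).norm_coe_le_norm x).trans_lt hf
  refine ⟨isClopen_preimage_nearOne f.continuous fun x => (hfx x).trans_le (by linarith),
    fun x => birkhoffSum_indicator_nearOne_eq_one (fun y => (hfx y).le) (by linarith) ?_⟩
  rw [← sum_inducedAut_iterate_apply]
  exact (ContinuousMap.norm_coe_le_norm (_ - 1) x).trans hsum.le

end Rounding

section Ultraproduct

variable {ι : Type*} {U : Ultrafilter ι}

theorem IsCyclicIdempotent.exists_approx {A : ι → Type*} [∀ i, CommCStarAlgebra (A i)]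
    [∀ i, Nontrivial (A i)] {σ : ∀ i, A i ≃⋆ₐ[ℂ] A i} {a : ℕ} {g : Ultraproduct U A}
    (hg : IsCyclicIdempotent (ultraAut U σ) a g) : ∃ f : lp A ∞, ∀ ε > 0, ∀ᶠ i in (U : Filter ι),
      ‖f i * f i - f i‖ < ε ∧ ‖∑ k ∈ Finset.range a, (σ i)^[k] (f i) - 1‖ < ε := by
  obtain ⟨f, rfl⟩ := Ultraproduct.mk_surjective U g
  refine ⟨f, fun ε hε => ?_⟩
  have hidem : Ultraproduct.mk U A (f * f) = Ultraproduct.mk U A f :=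
    (map_mul _ f f).trans hg.isIdempotentElem
  have hsum : Ultraproduct.mk U A (∑ k ∈ Finset.range a, (familyAut σ)^[k] f) =
      Ultraproduct.mk U A 1 :=
    (map_sum_iterate (semiconj_mkStar σ U) a f).trans (hg.sum_iterate.trans (map_one _).symm)
  filter_upwards [((Ultraproduct.mk_eq_mk_iff U).1 hidem).eventually_lt_const hε,
    ((Ultraproduct.mk_eq_mk_iff U).1 hsum).eventually_lt_const hε] with i hi hi'
  have happly : (∑ k ∈ Finset.range a, (familyAut σ)^[k] f) i =
      ∑ k ∈ Finset.range a, (σ i)^[k] (f i) := map_sum_iterate (semiconj_familyEval σ i) a f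
  exact ⟨hi, happly ▸ hi'⟩

theorem IsCyclicIdempotent.eventually_exists_isCyclicBase {X : ι → Type*}
    [∀ i, TopologicalSpace (X i)] [∀ i, CompactSpace (X i)] [∀ i, Nonempty (X i)]
    {S : ∀ i, X i ≃ₜ X i} {a : ℕ} {g : Ultraproduct U fun i => C(X i, ℂ)}
    (hg : IsCyclicIdempotent (ultraAut U fun i => inducedAut (S i)) a g) :
    ∀ᶠ i in (U : Filter ι), ∃ B, IsCyclicBase (S i) a B := by
  obtain ⟨f, hf⟩ := hg.exists_approx
  have ha : (0 : ℝ) < 4 * (a + 1) := by positivity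
  filter_upwards [hf _ (inv_pos.2 ha)] with i hi
  exact ⟨_, isCyclicBase_of_approx (inv_mul_cancel₀ ha.ne').le hi.1 hi.2⟩

end Ultraproduct

section Primes

variable {U : Ultrafilter Nat.Primes} {a : ℕ}

theorem eventually_coprime (hU : ∀ p, U ≠ pure p) (ha : 0 < a) :
    ∀ᶠ p : Nat.Primes in (U : Filter Nat.Primes), Nat.Coprime p a := by
  by_contra h
  rw [← Ultrafilter.eventually_not] at h
  have hfin : {p : Nat.Primes | ¬ Nat.Coprime p a}.Finite := by
    refine Set.Finite.of_finite_image (f := fun p : Nat.Primes => (p : ℕ))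
      ((Set.finite_Iic a).subset ?_) Nat.Primes.coe_nat_injective.injOn
    rintro _ ⟨p, hp, rfl⟩
    exact Nat.le_of_dvd ha (not_not.1 (mt (Nat.Prime.coprime_iff_not_dvd p.2).2 hp))
  obtain ⟨p, -, hp⟩ := Ultrafilter.eq_pure_of_finite_mem hfin h
  exact hU p hp

theorem IsCyclicIdempotent.length_eq_one (hU : ∀ p, U ≠ pure p)
    {g : Ultraproduct U fun p : Nat.Primes => C(ℕ → Fin (p : ℕ), ℂ)}
    (hg : IsCyclicIdempotent (primeUltraAut U) a g) : a = 1 := by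
  have hbase := hg.eventually_exists_isCyclicBase
  obtain ⟨p, B, hB⟩ := hbase.exists
  obtain ⟨p, hpa, B, hB⟩ := ((eventually_coprime hU hB.pos).and hbase).exists
  exact hB.length_eq_one_of_coprime fun _ => hpa

theorem IsElementaryEmbedding.length_eq_one_of_isCyclicBase (hU : ∀ p, U ≠ pure p) {A₀ : Type*}
    [CommCStarAlgebra A₀] {σ₀ : A₀ ≃⋆ₐ[ℂ] A₀}
    {j : A₀ →⋆ₐ[ℂ] Ultraproduct U fun p : Nat.Primes => C(ℕ → Fin (p : ℕ), ℂ)}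
    (hj : IsElementaryEmbedding σ₀ (primeUltraAut U) j) {Y : Type*} [TopologicalSpace Y]
    [CompactSpace Y] {τ : Y ≃ₜ Y} (hτ : Isomorphic σ₀ (inducedAut τ)) {B : Set Y}
    (hB : IsCyclicBase τ a B) : a = 1 := by
  obtain ⟨f, hf⟩ := hB.exists_isCyclicIdempotent
  obtain ⟨Φ, hΦ⟩ := hτ
  have hΦ' : Function.Semiconj Φ.symm (inducedAut τ) σ₀ :=
    Function.Semiconj.inverse_left hΦ Φ.left_inv Φ.right_inv
  exact ((hf.map hΦ').map hj.semiconj).length_eq_one hU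

end Primes

section Itinerary

variable {X K : Type*} {d : X → K} {t : X → X}

/-- The sequence of labels `d` along the orbit of a point under `t`. -/
def itinerary (d : X → K) (t : X → X) (x : X) : ℕ → K := fun n => d (t^[n] x)

theorem exists_itinerary_eq_on [Nonempty X] (h : ∀ i c, ∃ x, d x = i ∧ t x = c) (n : ℕ)
    (y : ℕ → K) : ∃ x, ∀ i < n, itinerary d t x i = y i := by
  induction n generalizing y with
  | zero => exact ‹Nonempty X›.elim fun x => ⟨x, by simp⟩
  | succ n ih =>
    obtain ⟨c, hc⟩ := ih fun k => y (k + 1)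
    obtain ⟨x, hx, rfl⟩ := h (y 0) c
    exact ⟨x, Nat.forall_lt_succ_left.2 ⟨hx, hc⟩⟩

variable [TopologicalSpace X] [TopologicalSpace K]

theorem continuous_itinerary (hd : Continuous d) (ht : Continuous t) :
    Continuous (itinerary d t) :=
  continuous_pi fun n => hd.comp (ht.iterate n)

theorem surjective_itinerary [Nonempty X] [CompactSpace X] [T2Space K] (hd : Continuous d)
    (ht : Continuous t) (h : ∀ i c, ∃ x, d x = i ∧ t x = c) :
    Function.Surjective (itinerary d t) := by
  intro y
  rw [← Set.mem_range, ← (isCompact_range (continuous_itinerary hd ht)).isClosed.closure_eq]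
  choose x hx using fun n => exists_itinerary_eq_on h n y
  refine mem_closure_of_tendsto (f := fun n => itinerary d t (x n)) (b := Filter.atTop)
    (tendsto_pi_nhds.2 fun k => tendsto_nhds_of_eventually_eq ?_) (.of_forall fun n => ⟨_, rfl⟩)
  filter_upwards [Filter.eventually_gt_atTop k] with n hn
  exact hx n k hn

end Itinerary

section Cantor

/-- The Cantor space decomposes into `p` copies of itself, where `d x` tells in which copy `x` lies
and `t x` is its position there, in such a way that the copy and the first `n` coordinates of the
position determine the first `n + s` coordinates of the point. -/
structure IsDecomposition {p : ℕ} (s : ℕ) (d : (ℕ → Bool) → Fin p)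
    (t : (ℕ → Bool) → ℕ → Bool) : Prop where
  continuous_copy : Continuous d
  continuous_position : Continuous t
  exists_eq : ∀ i c, ∃ x, d x = i ∧ t x = c
  eq_of_eq : ∀ {x y n}, d x = d y → (∀ i < n, t x i = t y i) → ∀ i < n + s, x i = y i

theorem continuous_if_of_isClopen {X Z : Type*} [TopologicalSpace X] [TopologicalSpace Z]
    {P : X → Prop} [DecidablePred P] (hP : IsClopen {x | P x}) {f g : X → Z} (hf : Continuous f)
    (hg : Continuous g) : Continuous fun x => if P x then f x else g x :=
  hf.if (fun x hx => by simp [hP.frontier_eq] at hx) hg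

variable {p : ℕ} {d : (ℕ → Bool) → Fin p} {t : (ℕ → Bool) → ℕ → Bool}

/-- Splitting one of the copies in two: the sequences starting with `true` become a copy of their
own, and the sequences starting with `false` are divided into the old copies. -/
theorem IsDecomposition.succ (h : IsDecomposition 0 d t) :
    IsDecomposition (p := p + 1) 1
      (fun x => if x 0 then 0 else (d fun n => x (n + 1)).succ)
      (fun x => if x 0 then fun n => x (n + 1) else t fun n => x (n + 1)) := by
  have hclopen : IsClopen {x : ℕ → Bool | x 0 = true} :=
    (isClopen_discrete {true}).preimage (continuous_apply 0)
  have htail : Continuous fun (x : ℕ → Bool) n => x (n + 1) := by fun_prop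
  refine ⟨continuous_if_of_isClopen hclopen continuous_const
      ((continuous_of_discreteTopology (f := Fin.succ)).comp (h.continuous_copy.comp htail)),
    continuous_if_of_isClopen hclopen htail (h.continuous_position.comp htail), fun i c => ?_,
    fun {x y n} hd ht => ?_⟩
  · cases i using Fin.cases with
    | zero => exact ⟨fun n => n.casesOn true c, by simp, by simp⟩
    | succ i =>
      obtain ⟨x, rfl, rfl⟩ := h.exists_eq i c
      exact ⟨fun n => n.casesOn false x, by simp, by simp⟩
  · have h0 : x 0 = y 0 := by
      cases hx : x 0 <;> cases hy : y 0 <;>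
        simp [hx, hy, Fin.succ_ne_zero, (Fin.succ_ne_zero _).symm] at hd ⊢
    refine Nat.forall_lt_succ_left.2 ⟨h0, ?_⟩
    cases hx : x 0
    · simp only [← h0, hx, Bool.false_eq_true, if_false, Fin.succ_inj] at hd ht
      exact h.eq_of_eq hd ht
    · simpa only [← h0, hx, if_true] using ht

theorem exists_isDecomposition (hp : 2 ≤ p) :
    ∃ d : (ℕ → Bool) → Fin p, ∃ t, IsDecomposition 1 d t := by
  induction p, hp using Nat.le_induction with
  | base =>
    exact ⟨_, _, IsDecomposition.succ (p := 1) (d := fun _ => 0) (t := id)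
      ⟨continuous_const, continuous_id, fun i c => ⟨c, Subsingleton.elim _ _, rfl⟩,
        fun _ h => h⟩⟩
  | succ p _ ih =>
    obtain ⟨d, t, h⟩ := ih
    exact ⟨_, _, IsDecomposition.succ ⟨h.continuous_copy, h.continuous_position, h.exists_eq,
      fun hd ht i hi => h.eq_of_eq hd ht i (hi.trans (Nat.lt_succ_self _))⟩⟩

theorem IsDecomposition.injective_itinerary (h : IsDecomposition 1 d t) :
    Function.Injective (itinerary d t) := by
  have hagree (n : ℕ) : ∀ x y, itinerary d t x = itinerary d t y → ∀ i < n, x i = y i := by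
    induction n with
    | zero => simp
    | succ n ih =>
      exact fun x y hxy => h.eq_of_eq (congrFun hxy 0)
        (ih (t x) (t y) (funext fun k => congrFun hxy (k + 1)))
  exact fun x y hxy => funext fun n => hagree (n + 1) x y hxy n n.lt_succ_self

theorem isCantorSet_pi_fin (hp : 2 ≤ p) : IsCantorSet (ℕ → Fin p) := by
  obtain ⟨d, t, h⟩ := exists_isDecomposition hp
  have hbij : Function.Bijective (itinerary d t) :=
    ⟨h.injective_itinerary,
      surjective_itinerary h.continuous_copy h.continuous_position h.exists_eq⟩
  exact ⟨(Continuous.homeoOfEquivCompactToT2 (f := Equiv.ofBijective _ hbij)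
    (continuous_itinerary h.continuous_copy h.continuous_position)).symm⟩

end Cantor

section Axiomatizability

theorem isOdometer_odometer {p : ℕ} (hp : 2 ≤ p) : IsOdometer (ℕ → Fin p) (odometer fun _ => p) :=
  ⟨fun _ => p, fun _ => hp, Homeomorph.refl _, fun _ => rfl⟩

theorem hyperfilter_ne_pure {α : Type*} [Infinite α] (x : α) : Filter.hyperfilter α ≠ pure x :=
  fun h => Filter.notMem_hyperfilter_of_finite (Set.finite_singleton x)
    (h ▸ Ultrafilter.mem_pure.2 (Set.mem_singleton x))

theorem not_separablyAxiomatizable : ¬ SeparablyAxiomatizable IsCantorSet IsOdometer := by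
  rintro ⟨T, hT⟩
  have hmodels (p : Nat.Primes) : Models (pOdometerAut p) T :=
    (hT _ _).2 ⟨ℕ → Fin (p : ℕ), inferInstance, inferInstance, inferInstance, _,
      isCantorSet_pi_fin p.2.two_le, isOdometer_odometer p.2.two_le,
      StarAlgEquiv.refl ℂ _, fun _ => rfl⟩
  obtain ⟨A₀, _, _, σ₀, j, hj⟩ :=
    exists_separable_elementary_substructure (primeUltraAut (Filter.hyperfilter Nat.Primes))
  obtain ⟨X, _, _, _, S, -, hS, hiso⟩ := (hT A₀ σ₀).1 (hj.models (Models.ultraAut _ _ hmodels))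
  obtain ⟨m, hm, B, hB⟩ := hS.exists_isCyclicBase
  have := hj.length_eq_one_of_isCyclicBase hyperfilter_ne_pure hiso hB
  omega

end Axiomatizability

end CStarDyn

end

theorem theorem2p6_general :
    ¬ CStarDyn.SeparablyAxiomatizable CStarDyn.IsCantorSet CStarDyn.IsOdometer ∧
    ∀ U : Ultrafilter Nat.Primes, (∀ p, U ≠ pure p) →
      (∃ (A₀ : Type) (_ : CommCStarAlgebra A₀) (_ : TopologicalSpace.SeparableSpace A₀)
        (σ₀ : A₀ ≃⋆ₐ[ℂ] A₀)
        (j : A₀ →⋆ₐ[ℂ] CStarDyn.Ultraproduct U fun p : Nat.Primes => C(ℕ → Fin (p : ℕ), ℂ)),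
        CStarDyn.IsElementaryEmbedding σ₀ (CStarDyn.primeUltraAut U) j) ∧
      ∀ (A₀ : Type*) [CommCStarAlgebra A₀] (σ₀ : A₀ ≃⋆ₐ[ℂ] A₀)
        (j : A₀ →⋆ₐ[ℂ] CStarDyn.Ultraproduct U fun p : Nat.Primes => C(ℕ → Fin (p : ℕ), ℂ)),
        CStarDyn.IsElementaryEmbedding σ₀ (CStarDyn.primeUltraAut U) j →
        (∀ T : CStarDyn.Theory, (∀ p : Nat.Primes, CStarDyn.Models (CStarDyn.pOdometerAut p) T) →
          CStarDyn.Models σ₀ T) ∧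
        ∀ (Y : Type*) [TopologicalSpace Y] [CompactSpace Y] (τ : Y ≃ₜ Y),
          CStarDyn.Isomorphic σ₀ (CStarDyn.inducedAut τ) →
          ¬ CStarDyn.HasOdometerPartitions τ := by
  refine ⟨CStarDyn.not_separablyAxiomatizable, fun U hU =>
    ⟨CStarDyn.exists_separable_elementary_substructure _, fun A₀ _ σ₀ j hj =>
      ⟨fun T hT => hj.models (CStarDyn.Models.ultraAut U _ hT), fun Y _ _ τ hiso hτ => ?_⟩⟩⟩
  obtain ⟨a, ha, B, hB⟩ := hτ.exists_isCyclicBase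
  have := hj.length_eq_one_of_isCyclicBase hU hiso hB
  omega

theorem theorem2p6 :
    ¬ CStarDyn.SeparablyAxiomatizable CStarDyn.IsCantorSet CStarDyn.IsOdometer ∧
    ∀ U : Ultrafilter Nat.Primes, (∀ p, U ≠ pure p) →
      (∃ (A₀ : Type) (_ : CommCStarAlgebra A₀) (_ : TopologicalSpace.SeparableSpace A₀)
        (σ₀ : A₀ ≃⋆ₐ[ℂ] A₀)
        (j : A₀ →⋆ₐ[ℂ] CStarDyn.Ultraproduct U fun p : Nat.Primes => C(ℕ → Fin (p : ℕ), ℂ)),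
        CStarDyn.IsElementaryEmbedding σ₀ (CStarDyn.primeUltraAut U) j) ∧
      ∀ (A₀ : Type) [CommCStarAlgebra A₀] [TopologicalSpace.SeparableSpace A₀]
        (σ₀ : A₀ ≃⋆ₐ[ℂ] A₀)
        (j : A₀ →⋆ₐ[ℂ] CStarDyn.Ultraproduct U fun p : Nat.Primes => C(ℕ → Fin (p : ℕ), ℂ)),
        CStarDyn.IsElementaryEmbedding σ₀ (CStarDyn.primeUltraAut U) j →
        (∀ T : CStarDyn.Theory, (∀ p : Nat.Primes, CStarDyn.Models (CStarDyn.pOdometerAut p) T) →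
          CStarDyn.Models σ₀ T) ∧
        ∀ (Y : Type) [TopologicalSpace Y] [CompactSpace Y] [T2Space Y] (τ : Y ≃ₜ Y),
          CStarDyn.Isomorphic σ₀ (CStarDyn.inducedAut τ) →
          ¬ CStarDyn.HasOdometerPartitions τ :=
  ⟨theorem2p6_general.{0, 0}.1, fun U hU => (theorem2p6_general.{0, 0}.2 U hU).imp_right
    fun h A₀ _ _ σ₀ j hj => (h A₀ σ₀ j hj).imp_right fun hτ Y _ _ _ => hτ Y⟩
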